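/- An equivalence structure is a pair $\mathcal A=(A,E)$ with $A\subseteq\omega$ and $E$ an equivalence relation on $A$; it is computable if $A$ and $E$ are computable. An embedding of equivalence structures is an injective map that preserves and reflects the equivalence relation; $\mathcal A$ and $\mathcal B$ are bi-embeddable ($\mathcal B$ is a bi-embeddable copy of $\mathcal A$) if each embeds in the other. The degree of bi-embeddable categoricity of a computable equivalence structure $\mathcal A$ is, if it exists, the least Turing degree $\mathbf d$ such that for any two computable bi-embeddable copies $\mathcal B,\mathcal C$ of $\mathcal A$ there are $\mathbf d$-computable embeddings of $\mathcal B$ in $\mathcal C$ and of $\mathcal C$ in $\mathcal B$. Let $(\varphi_e)_{e\in\omega}$ be a standard enumeration of the partial computable functions of two variables. If $\varphi_e$ is total with values in $\{0,1\}$ and $\{(x,y):\varphi_e(x,y)=1\}$ is an equivalence relation on $\omega$, let $\mathcal C_e$ be the computable equivalence structure with universe $\omega$ and this relation; otherwise $\mathcal C_e$ is not defined, and $e$ belongs to no index set. A set is $\Pi^0_4$-complete if it is $\Pi^0_4$ and every $\Pi^0_4$ set is reducible to it by an injective computable function. **Theorem.** The index set $$\{e : \mathcal C_e \text{ is defined and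 has degree of bi-embeddable categoricity } \mathbf 0''\}$$ is $\Pi^0_4$-complete. Moreover, it is equal to $$\{e : \mathcal C_e \text{ is defined and has infinitely many infinite equivalence classes}\}.$$ -/

import Mathlib

open scoped Computability

/-! ### Turing reducibility of sets and the Turing jump -/

/-- The characteristic function of a set of natural numbers, as an oracle. -/
noncomputable def charFun (X : Set ℕ) : ℕ →. ℕ :=
  fun n => Part.some (X.indicator (fun _ => 1) n)

/-- Turing reducibility `X ≤_T Y` of sets of natural numbers. -/
def SetTuringReducible (X Y : Set ℕ) : Prop := charFun X ≤ᵀ charFun Y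

/-- Programs for partial functions computed with an oracle; the constructors are those of
`Nat.RecursiveIn`. -/
inductive OracleCode : Type
  | zero : OracleCode
  | succ : OracleCode
  | left : OracleCode
  | right : OracleCode
  | oracle : OracleCode
  | pair : OracleCode → OracleCode → OracleCode
  | comp : OracleCode → OracleCode → OracleCode
  | prec : OracleCode → OracleCode → OracleCode
  | rfind : OracleCode → OracleCode

namespace OracleCode

/-- The partial function computed by a program with oracle `g`. -/
def eval (g : ℕ →. ℕ) : OracleCode → ℕ →. ℕ
  | zero => fun _ => Part.some 0
  | succ => fun n => Part.some (n + 1)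
  | left => fun n => Part.some (Nat.unpair n).1
  | right => fun n => Part.some (Nat.unpair n).2
  | oracle => g
  | pair cf ch => fun n => Nat.pair <$> eval g cf n <*> eval g ch n
  | comp cf ch => fun n => eval g ch n >>= eval g cf
  | prec cf ch => fun p =>
      Nat.rec (motive := fun _ => Part ℕ) (eval g cf (Nat.unpair p).1)
        (fun y IH => IH >>= fun i => eval g ch (Nat.pair (Nat.unpair p).1 (Nat.pair y i)))
        (Nat.unpair p).2
  | rfind cf => fun a => Nat.rfind fun n => (fun m => decide (m = 0)) <$> eval g cf (Nat.pair a n)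

/-- The Gödel number of a program. -/
def encode : OracleCode → ℕ
  | zero => 0
  | succ => 1
  | left => 2
  | right => 3
  | oracle => 4
  | pair cf ch => 4 * Nat.pair (encode cf) (encode ch) + 5
  | comp cf ch => 4 * Nat.pair (encode cf) (encode ch) + 6
  | prec cf ch => 4 * Nat.pair (encode cf) (encode ch) + 7
  | rfind cf => 4 * encode cf + 8

/-- The program with a given Gödel number. -/
def ofNat : ℕ → OracleCode
  | 0 => zero
  | 1 => succ
  | 2 => left
  | 3 => right
  | 4 => oracle
  | n + 5 =>
    have h1 : (n / 4).unpair.1 < n + 5 := by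
      have := Nat.unpair_left_le (n / 4); omega
    have h2 : (n / 4).unpair.2 < n + 5 := by
      have := Nat.unpair_right_le (n / 4); omega
    match n % 4 with
    | 0 => pair (ofNat (n / 4).unpair.1) (ofNat (n / 4).unpair.2)
    | 1 => comp (ofNat (n / 4).unpair.1) (ofNat (n / 4).unpair.2)
    | 2 => prec (ofNat (n / 4).unpair.1) (ofNat (n / 4).unpair.2)
    | _ => rfind (ofNat (n / 4))

theorem ofNat_encode (c : OracleCode) : ofNat (encode c) = c := by
  induction c with
  | zero | succ | left | right | oracle => simp [encode, ofNat]
  | pair a b iha ihb =>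
    rw [encode, ofNat]
    simp [iha, ihb]
  | comp a b iha ihb =>
    rw [encode, show 4 * Nat.pair a.encode b.encode + 6
      = (4 * Nat.pair a.encode b.encode + 1) + 5 by omega, ofNat,
      show (4 * Nat.pair a.encode b.encode + 1) % 4 = 1 by omega,
      show (4 * Nat.pair a.encode b.encode + 1) / 4 = Nat.pair a.encode b.encode by omega]
    simp [iha, ihb]
  | prec a b iha ihb =>
    rw [encode, show 4 * Nat.pair a.encode b.encode + 7
      = (4 * Nat.pair a.encode b.encode + 2) + 5 by omega, ofNat,
      show (4 * Nat.pair a.encode b.encode + 2) % 4 = 2 by omega,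
      show (4 * Nat.pair a.encode b.encode + 2) / 4 = Nat.pair a.encode b.encode by omega]
    simp [iha, ihb]
  | rfind a iha =>
    rw [encode, show 4 * a.encode + 8 = (4 * a.encode + 3) + 5 by omega, ofNat,
      show (4 * a.encode + 3) % 4 = 3 by omega,
      show (4 * a.encode + 3) / 4 = a.encode by omega]
    simp [iha]

/-- The programs compute exactly the partial functions that are recursive in the oracle. -/
theorem exists_ofNat_iff {g f : ℕ →. ℕ} :
    Nat.RecursiveIn {g} f ↔ ∃ e : ℕ, eval g (ofNat e) = f := by
  have key : Nat.RecursiveIn {g} f ↔ ∃ c : OracleCode, eval g c = f := by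
    constructor
    · intro h
      induction h with
      | zero => exact ⟨zero, rfl⟩
      | succ => exact ⟨succ, rfl⟩
      | left => exact ⟨left, rfl⟩
      | right => exact ⟨right, rfl⟩
      | oracle k hk => exact ⟨oracle, (Set.mem_singleton_iff.1 hk).symm⟩
      | pair _ _ ih1 ih2 =>
        obtain ⟨c, rfl⟩ := ih1
        obtain ⟨d, rfl⟩ := ih2
        exact ⟨pair c d, rfl⟩
      | comp _ _ ih1 ih2 =>
        obtain ⟨c, rfl⟩ := ih1
        obtain ⟨d, rfl⟩ := ih2
        exact ⟨comp c d, rfl⟩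
      | prec _ _ ih1 ih2 =>
        obtain ⟨c, rfl⟩ := ih1
        obtain ⟨d, rfl⟩ := ih2
        exact ⟨prec c d, rfl⟩
      | rfind _ ih =>
        obtain ⟨c, rfl⟩ := ih
        exact ⟨rfind c, rfl⟩
    · rintro ⟨c, rfl⟩
      induction c with
      | zero => exact .zero
      | succ => exact .succ
      | left => exact .left
      | right => exact .right
      | oracle => exact .oracle g rfl
      | pair _ _ ih1 ih2 => exact .pair ih1 ih2
      | comp _ _ ih1 ih2 => exact .comp ih1 ih2
      | prec _ _ ih1 ih2 => exact .prec ih1 ih2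
      | rfind _ ih => exact .rfind ih
  rw [key]
  constructor
  · rintro ⟨c, rfl⟩
    exact ⟨encode c, by rw [ofNat_encode]⟩
  · rintro ⟨e, rfl⟩
    exact ⟨_, rfl⟩

end OracleCode

/-- The Turing jump of `X`: the set of `e` such that the `e`-th program with oracle `X` halts on
input `e`. -/
def turingJump (X : Set ℕ) : Set ℕ :=
  {e | ((OracleCode.ofNat e).eval (charFun X) e).Dom}

/-! ### The arithmetical hierarchy -/

/-- `A` is `Σ⁰ₙ`: the sets `Σ⁰₀` are the computable ones, and `A` is `Σ⁰ₙ₊₁` if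
`a ∈ A ↔ ∃ x, ⟨a, x⟩ ∉ B` for some `Σ⁰ₙ` set `B` (so that the complement of `B` is `Π⁰ₙ`). -/
def IsSigma0 : ℕ → Set ℕ → Prop
  | 0, A => ComputablePred (fun a => a ∈ A)
  | n + 1, A => ∃ B : Set ℕ, IsSigma0 n B ∧ ∀ a, a ∈ A ↔ ∃ x, Nat.pair a x ∉ B

/-- `A` is `Π⁰ₙ` if its complement is `Σ⁰ₙ`. -/
def IsPi0 (n : ℕ) (A : Set ℕ) : Prop := IsSigma0 n Aᶜ

/-- `A` is `Π⁰ₙ`-complete: it is `Π⁰ₙ`, and every `Π⁰ₙ` set is reducible to it by an injective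
computable function. -/
def IsPi0Complete (n : ℕ) (A : Set ℕ) : Prop :=
  IsPi0 n A ∧ ∀ B : Set ℕ, IsPi0 n B → OneOneReducible (fun b => b ∈ B) (fun a => a ∈ A)

/-! ### Equivalence structures and their embeddings -/

/-- An equivalence structure with universe a set of natural numbers. -/
structure EquivStructure where
  carrier : Set ℕ
  eqv : Setoid carrier

namespace EquivStructure

/-- The universe and the equivalence relation (that is, the atomic diagram) are computable. -/
def IsComputable (A : EquivStructure) : Prop :=
  ComputablePred (fun n : ℕ => n ∈ A.carrier) ∧
  ComputablePred (fun p : ℕ × ℕ =>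
    ∃ (hx : p.1 ∈ A.carrier) (hy : p.2 ∈ A.carrier), A.eqv.r ⟨p.1, hx⟩ ⟨p.2, hy⟩)

/-- Embeddings of structures: injective maps that preserve and reflect the relation. -/
abbrev Embedding (A B : EquivStructure) : Type := A.eqv.r ↪r B.eqv.r

/-- Each of the structures embeds in the other. -/
def BiEmbeddable (A B : EquivStructure) : Prop :=
  Nonempty (Embedding A B) ∧ Nonempty (Embedding B A)

/-- An embedding as a partial function on the natural numbers, defined on the universe of `A`. -/
def Embedding.toPFun {A B : EquivStructure} (f : Embedding A B) : ℕ →. ℕ :=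
  fun n => ⟨n ∈ A.carrier, fun h => (f ⟨n, h⟩ : ℕ)⟩

/-- `X` computes embeddings between any two computable bi-embeddable copies of `A` (in both
directions, as the pair `(B, C)` is ordered). -/
def ComputesEmbeddings (A : EquivStructure) (X : Set ℕ) : Prop :=
  ∀ B C : EquivStructure, B.IsComputable → C.IsComputable →
    BiEmbeddable A B → BiEmbeddable A C →
    ∃ f : Embedding B C, Embedding.toPFun f ≤ᵀ charFun X

/-- The Turing degree of `X` is the degree of bi-embeddable categoricity of `A`: it is the least
Turing degree that computes embeddings between any two computable bi-embeddable copies of `A`. -/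
def HasBiembCatDegree (A : EquivStructure) (X : Set ℕ) : Prop :=
  A.ComputesEmbeddings X ∧ ∀ Y : Set ℕ, A.ComputesEmbeddings Y → SetTuringReducible X Y

/-- `A` has infinitely many infinite equivalence classes. -/
def HasInfinitelyManyInfiniteClasses (A : EquivStructure) : Prop :=
  {c : Set A.carrier | c ∈ A.eqv.classes ∧ c.Infinite}.Infinite

end EquivStructure

/-! ### The enumeration of the computable equivalence structures with universe `ω` -/

/-- The `e`-th partial computable function of two variables. -/
def phi (e x y : ℕ) : Part ℕ :=
  (Denumerable.ofNat Nat.Partrec.Code e).eval (Nat.pair x y)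

/-- The function `phi e` is total with values in `{0, 1}`, and `phi e x y = 1` defines an
equivalence relation on the natural numbers. -/
def IsEquivIndex (e : ℕ) : Prop :=
  (∀ x y, phi e x y = Part.some 0 ∨ phi e x y = Part.some 1) ∧
  Equivalence (fun x y => phi e x y = Part.some 1)

/-- The equivalence structure `C_e` with index `e`. -/
def structureOfIndex (e : ℕ) (h : IsEquivIndex e) : EquivStructure where
  carrier := Set.univ
  eqv :=
    { r := fun x y => phi e x y = Part.some 1
      iseqv := ⟨fun x => h.2.refl x, fun hxy => h.2.symm hxy, fun hxy hyz => h.2.trans hxy hyz⟩ }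

/-- The index set of the equivalence structures whose degree of bi-embeddable categoricity is the
second jump of the degree of the computable sets. -/
def zeroDoubleJumpIndexSet : Set ℕ :=
  {e | ∃ h : IsEquivIndex e,
    (structureOfIndex e h).HasBiembCatDegree (turingJump (turingJump ∅))}

/-! ### Closure properties of computable predicates -/

section ComputablePred

variable {α β : Type*} [Primcodable α] [Primcodable β]

/-! Both claims rest on one fact: `0''` is the degree of `A` exactly when `A` has infinitely many
infinite classes.

Upper bounds. Given an embedding of `B` in `C`, well-foundedness of `ℕ∞` shows that all but finitely
many classes of `B` have a size that infinitely many classes of `C` reach or exceed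
(`EmbedsOn.exists_bound`). So a finite part of the embedding, which can be hard-wired, extends
greedily: each new class goes to a fresh class that is large enough, and later elements of a class
always find room in its image (`GreedyEmbeddable`). Comparing the sizes of two classes is `Π⁰₂`, so
`0''` always suffices. If `C` has only finitely many infinite classes, the classes placed greedily
are finite, and a search for a bound on the class together with enough elements of the target needs
only a `Π⁰₁` test, so `0'` suffices. Since `0''` is not computable from `0'`, it is then not the
least degree.

Lower bound. Structures with infinitely many infinite classes are all bi-embeddable. One computable
copy consists of infinite columns only; in another, column `c` is infinite exactly when `c` codes a
correct list of answers, with evidence, about an initial segment of `0''`. Correctness is `Π⁰₂`,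
hence can be expressed by infinitely many occurrences of a computable event. Evidence is made unique
(`ArithPi.exists_unique_witness`), so there is one infinite class for each length. An embedding of
the first copy in the second hits infinitely many of these lists, so it computes `0''`.

Completeness. Having infinitely many infinite classes is `Π⁰₄` by counting quantifiers. For
hardness, write `b ∈ B` as `∀ i, ∃ v` of a `Π⁰₂` predicate and use the same lists: there is one of
every length exactly if every `i` has a witness, and otherwise only finitely many
(`ArithPi.exists_witness_lists`). -/

theorem ComputablePred.comp {p : β → Prop} (hp : ComputablePred p) {f : α → β}
    (hf : Computable f) : ComputablePred fun a => p (f a) := by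
  classical
  exact (hp.decide.comp hf).computablePred

theorem ComputablePred.and {p q : α → Prop} (hp : ComputablePred p) (hq : ComputablePred q) :
    ComputablePred fun a => p a ∧ q a := by
  classical
  refine Computable.computablePred ((Primrec.and.to_comp.comp hp.decide hq.decide).of_eq ?_)
  intro a
  simp

theorem ComputablePred.or {p q : α → Prop} (hp : ComputablePred p) (hq : ComputablePred q) :
    ComputablePred fun a => p a ∨ q a :=
  (hp.not.and hq.not).not.of_eq fun a => by tauto

theorem ComputablePred.imp {p q : α → Prop} (hp : ComputablePred p) (hq : ComputablePred q) :
    ComputablePred fun a => p a → q a :=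
  (hp.not.or hq).of_eq fun a => by tauto

theorem ComputablePred.iff {p q : α → Prop} (hp : ComputablePred p) (hq : ComputablePred q) :
    ComputablePred fun a => (p a ↔ q a) :=
  ((hp.imp hq).and (hq.imp hp)).of_eq fun a => by tauto

theorem ComputablePred.const (p : Prop) : ComputablePred fun _ : α => p := by
  classical
  exact Computable.computablePred (Computable.const _)

theorem Computable.eq_pred {f g : α → β} (hf : Computable f) (hg : Computable g) :
    ComputablePred fun a => f a = g a := by
  classical
  exact Computable.computablePred ((Primrec.eq (α := β)).decide.to_comp.comp hf hg)

theorem Computable.lt_pred {f g : α → ℕ} (hf : Computable f) (hg : Computable g) :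
    ComputablePred fun a => f a < g a :=
  Computable.computablePred (Primrec.nat_lt.decide.to_comp.comp hf hg)

theorem Computable.le_pred {f g : α → ℕ} (hf : Computable f) (hg : Computable g) :
    ComputablePred fun a => f a ≤ g a :=
  Computable.computablePred (Primrec.nat_le.decide.to_comp.comp hf hg)

theorem Computable.unpair_fst {f : α → ℕ} (hf : Computable f) :
    Computable fun a => (f a).unpair.1 :=
  Computable.fst.comp (Computable.unpair.comp hf)

theorem Computable.unpair_snd {f : α → ℕ} (hf : Computable f) :
    Computable fun a => (f a).unpair.2 :=
  Computable.snd.comp (Computable.unpair.comp hf)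

theorem Computable.natPair {f g : α → ℕ} (hf : Computable f) (hg : Computable g) :
    Computable fun a => Nat.pair (f a) (g a) :=
  Primrec₂.natPair.to_comp.comp hf hg

open Classical in
/-- The number of `k < s` that satisfy `p`. -/
noncomputable def countBelow (p : ℕ → Prop) (s : ℕ) : ℕ := Nat.count p s

theorem countBelow_computable {p : α × ℕ → Prop} (hp : ComputablePred p) {f : α → ℕ}
    (hf : Computable f) : Computable fun a => countBelow (fun k => p (a, k)) (f a) := by
  classical
  have hstep : Computable₂ fun (a : α) (y : ℕ × ℕ) =>
      y.2 + bif decide (p (a, y.1)) then 1 else 0 := by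
    refine Primrec.nat_add.to_comp.comp (Computable.snd.comp Computable.snd) ?_
    refine Computable.cond ?_ (Computable.const 1) (Computable.const 0)
    exact hp.decide.comp (Computable.fst.pair (Computable.fst.comp Computable.snd))
  refine (Computable.nat_rec hf (Computable.const 0) hstep).of_eq fun a => ?_
  unfold countBelow
  induction f a with
  | zero => simp
  | succ n ih =>
    rw [Nat.count_succ, ← ih]
    simp [Bool.cond_decide]

theorem ComputablePred.forall_lt {p : α × ℕ → Prop} (hp : ComputablePred p) {f : α → ℕ}
    (hf : Computable f) : ComputablePred fun a => ∀ k < f a, p (a, k) := by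
  classical
  refine (Computable.eq_pred (countBelow_computable hp hf) hf).of_eq fun a => ?_
  unfold countBelow
  exact Nat.count_iff_forall

theorem ComputablePred.exists_lt {p : α × ℕ → Prop} (hp : ComputablePred p) {f : α → ℕ}
    (hf : Computable f) : ComputablePred fun a => ∃ k < f a, p (a, k) :=
  (ComputablePred.forall_lt hp.not hf).not.of_eq fun a => by push Not; rfl

end ComputablePred

/-! ### The arithmetical hierarchy for predicates on encodable types -/

/-- The `Σ⁰ₙ` predicates on a type with a computable encoding. -/
def ArithSigma : ℕ → ∀ {α : Type} [Primcodable α], (α → Prop) → Prop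
  | 0, _, _, p => ComputablePred p
  | n + 1, α, _, p => ∃ q : α × ℕ → Prop, ArithSigma n q ∧ ∀ a, p a ↔ ∃ x, ¬ q (a, x)

/-- The `Π⁰ₙ` predicates on a type with a computable encoding. -/
def ArithPi (n : ℕ) {α : Type} [Primcodable α] (p : α → Prop) : Prop :=
  ArithSigma n fun a => ¬ p a

section Arith

variable {α β : Type} [Primcodable α] [Primcodable β] {n : ℕ} {p q : α → Prop}

theorem ArithSigma.of_iff (hp : ArithSigma n p) (h : ∀ a, q a ↔ p a) : ArithSigma n q := by
  rwa [show q = p from funext fun a => propext (h a)]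

theorem ArithPi.of_iff (hp : ArithPi n p) (h : ∀ a, q a ↔ p a) : ArithPi n q := by
  rwa [show q = p from funext fun a => propext (h a)]

theorem ArithSigma.not (hp : ArithSigma n p) : ArithPi n fun a => ¬ p a :=
  ArithSigma.of_iff hp fun _ => not_not

theorem ArithSigma.comp {p : β → Prop} (hp : ArithSigma n p) {f : α → β} (hf : Computable f) :
    ArithSigma n fun a => p (f a) := by
  induction n generalizing α β with
  | zero => exact ComputablePred.comp hp hf
  | succ n ih =>
    obtain ⟨q, hq, h⟩ := hp
    exact ⟨fun y => q (f y.1, y.2),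
      ih hq (f := fun y : α × ℕ => (f y.1, y.2)) ((hf.comp Computable.fst).pair Computable.snd),
      fun a => h (f a)⟩

theorem ArithPi.comp {p : β → Prop} (hp : ArithPi n p) {f : α → β} (hf : Computable f) :
    ArithPi n fun a => p (f a) :=
  ArithSigma.comp hp hf

theorem ArithPi.sigma_succ (hp : ArithPi n p) : ArithSigma (n + 1) p :=
  ⟨fun y => ¬ p y.1, ArithSigma.comp hp Computable.fst, fun a => by simp⟩

theorem ArithSigma.pi_succ (hp : ArithSigma n p) : ArithPi (n + 1) p :=
  hp.not.sigma_succ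

theorem ArithSigma.succ (hp : ArithSigma n p) : ArithSigma (n + 1) p := by
  induction n generalizing α with
  | zero => exact ArithPi.sigma_succ (ComputablePred.not hp)
  | succ n ih =>
    obtain ⟨q, hq, h⟩ := hp
    exact ⟨q, ih hq, h⟩

theorem ArithPi.succ (hp : ArithPi n p) : ArithPi (n + 1) p := ArithSigma.succ hp

theorem ComputablePred.arithSigma (hp : ComputablePred p) : ArithSigma n p := by
  induction n with
  | zero => exact hp
  | succ n ih => exact ih.succ

theorem ComputablePred.arithPi (hp : ComputablePred p) : ArithPi n p :=
  hp.not.arithSigma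

/-- The negation in the inductive definition turns a conjunction at level `n + 1` into a disjunction
at level `n` and conversely, so the two closure properties need a common induction. -/
theorem ArithSigma.and_or (hp : ArithSigma n p) (hq : ArithSigma n q) :
    ArithSigma n (fun a => p a ∧ q a) ∧ ArithSigma n (fun a => p a ∨ q a) := by
  induction n generalizing α with
  | zero => exact ⟨ComputablePred.and hp hq, ComputablePred.or hp hq⟩
  | succ n ih =>
    obtain ⟨p', hp', h⟩ := hp
    obtain ⟨q', hq', h'⟩ := hq
    have key := ih
      (hp'.comp (f := fun y : α × ℕ => (y.1, y.2.unpair.1))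
        (Computable.fst.pair (Computable.unpair_fst Computable.snd)))
      (hq'.comp (f := fun y : α × ℕ => (y.1, y.2.unpair.2))
        (Computable.fst.pair (Computable.unpair_snd Computable.snd)))
    refine ⟨⟨_, key.2, fun a => ?_⟩, ⟨_, key.1, fun a => ?_⟩⟩
    · beta_reduce
      rw [h, h']
      constructor
      · rintro ⟨⟨x, hx⟩, y, hy⟩
        exact ⟨Nat.pair x y, by simp [hx, hy]⟩
      · rintro ⟨z, hz⟩
        rw [not_or] at hz
        exact ⟨⟨_, hz.1⟩, _, hz.2⟩
    · beta_reduce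
      rw [h, h']
      constructor
      · rintro (⟨x, hx⟩ | ⟨x, hx⟩)
        · exact ⟨Nat.pair x 0, by simp [hx]⟩
        · exact ⟨Nat.pair 0 x, by simp [hx]⟩
      · rintro ⟨z, hz⟩
        rw [not_and_or] at hz
        exact hz.imp (fun hz => ⟨_, hz⟩) fun hz => ⟨_, hz⟩

theorem ArithSigma.and (hp : ArithSigma n p) (hq : ArithSigma n q) :
    ArithSigma n (fun a => p a ∧ q a) := (hp.and_or hq).1

theorem ArithSigma.or (hp : ArithSigma n p) (hq : ArithSigma n q) :
    ArithSigma n (fun a => p a ∨ q a) := (hp.and_or hq).2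

theorem ArithPi.and (hp : ArithPi n p) (hq : ArithPi n q) : ArithPi n (fun a => p a ∧ q a) :=
  (ArithSigma.or hp hq).of_iff fun _ => not_and_or

theorem ArithPi.or (hp : ArithPi n p) (hq : ArithPi n q) : ArithPi n (fun a => p a ∨ q a) :=
  (ArithSigma.and hp hq).of_iff fun _ => not_or

theorem ArithPi.imp (hp : ArithSigma n p) (hq : ArithPi n q) : ArithPi n (fun a => p a → q a) :=
  (hp.not.or hq).of_iff fun _ => by tauto

theorem ArithSigma.exists_nat {p : α × ℕ → Prop} (hp : ArithSigma (n + 1) p) :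
    ArithSigma (n + 1) fun a => ∃ x, p (a, x) := by
  obtain ⟨q, hq, h⟩ := hp
  refine ⟨fun y => q ((y.1, y.2.unpair.1), y.2.unpair.2), hq.comp (α := α × ℕ)
    ((Computable.fst.pair (Computable.unpair_fst Computable.snd)).pair
      (Computable.unpair_snd Computable.snd)), fun a => ?_⟩
  constructor
  · rintro ⟨x, hx⟩
    obtain ⟨y, hy⟩ := (h _).1 hx
    exact ⟨Nat.pair x y, by simpa using hy⟩
  · rintro ⟨z, hz⟩
    exact ⟨_, (h _).2 ⟨_, hz⟩⟩

theorem ArithPi.forall_nat {p : α × ℕ → Prop} (hp : ArithPi (n + 1) p) :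
    ArithPi (n + 1) fun a => ∀ x, p (a, x) :=
  (ArithSigma.exists_nat hp).of_iff fun _ => not_forall

theorem ArithSigma.exists_denumerable {γ : Type} [Denumerable γ] {p : α × γ → Prop}
    (hp : ArithSigma (n + 1) p) : ArithSigma (n + 1) fun a => ∃ x, p (a, x) := by
  refine (ArithSigma.exists_nat (hp.comp (f := fun y : α × ℕ => (y.1, Denumerable.ofNat γ y.2))
    (Computable.fst.pair ((Computable.ofNat γ).comp Computable.snd)))).of_iff fun a => ?_
  constructor
  · rintro ⟨x, hx⟩
    exact ⟨Encodable.encode x, by simpa using hx⟩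
  · rintro ⟨x, hx⟩
    exact ⟨_, hx⟩

theorem isSigma0_iff {A : Set ℕ} : IsSigma0 n A ↔ ArithSigma n (fun a => a ∈ A) := by
  induction n generalizing A with
  | zero => rfl
  | succ n ih =>
    constructor
    · rintro ⟨B, hB, h⟩
      exact ⟨fun y => Nat.pair y.1 y.2 ∈ B, (ih.1 hB).comp (α := ℕ × ℕ)
        (Computable.natPair Computable.fst Computable.snd), h⟩
    · rintro ⟨q, hq, h⟩
      refine ⟨{z | q z.unpair}, ih.2 (hq.comp (f := Nat.unpair) Computable.unpair), fun a => ?_⟩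
      simpa using h a

theorem isPi0_iff {A : Set ℕ} : IsPi0 n A ↔ ArithPi n (fun a => a ∈ A) := isSigma0_iff

end Arith

/-! ### The Turing jump -/

open Nat.Partrec (Code)

theorem charFun_eq_zero {X : Set ℕ} {n : ℕ} : 0 ∈ charFun X n ↔ n ∉ X := by
  classical
  by_cases h : n ∈ X <;> simp [charFun, h]

theorem rfind_zero_dom_iff {f : ℕ → Part ℕ} (hf : ∀ n, (f n).Dom) :
    (Nat.rfind fun n => (fun m => decide (m = 0)) <$> f n).Dom ↔ ∃ n, 0 ∈ f n := by
  refine Nat.rfind_dom.trans ⟨?_, ?_⟩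
  · rintro ⟨x, hx, -⟩
    obtain ⟨y, hy, h0⟩ := (Part.mem_map_iff _).1 hx
    obtain rfl : y = 0 := by simpa using h0
    exact ⟨x, hy⟩
  · rintro ⟨x, hx⟩
    exact ⟨x, (Part.mem_map_iff _).2 ⟨0, hx, by simp⟩, fun _ => hf _⟩

theorem charFun_eq_of_iff {X Y : Set ℕ} {f : ℕ → ℕ} (h : ∀ n, n ∈ X ↔ f n ∈ Y) :
    charFun X = fun n => charFun Y (f n) := by
  classical
  funext n
  by_cases hn : f n ∈ Y <;> simp [charFun, h, hn]

theorem SetTuringReducible.of_iff {X Y : Set ℕ} {f : ℕ → ℕ} (hf : Computable f)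
    (h : ∀ n, n ∈ X ↔ f n ∈ Y) : SetTuringReducible X Y := by
  unfold SetTuringReducible TuringReducible
  refine RecursiveIn.iff_nat.2 ((Nat.RecursiveIn.comp (.oracle (charFun Y) (Set.mem_singleton _))
    (Partrec.nat_iff.1 hf).recursiveIn).of_eq fun n => ?_)
  rw [charFun_eq_of_iff h]
  exact Part.bind_some _ _

theorem SetTuringReducible.compl {X Y : Set ℕ} (h : SetTuringReducible X Y) :
    SetTuringReducible Xᶜ Y := by
  classical
  unfold SetTuringReducible TuringReducible at *
  rw [RecursiveIn.iff_nat] at *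
  have hsub : Computable fun n : ℕ => 1 - n :=
    Primrec.nat_sub.to_comp.comp (Computable.const 1) Computable.id
  refine ((Partrec.nat_iff.1 hsub).recursiveIn.comp h).of_eq fun n => ?_
  refine (Part.bind_some _ _).trans ?_
  by_cases hn : n ∈ X <;> simp [charFun, hn]

/-- A set whose complement is searched for recursively in `X` is recursively enumerable in `X`,
so it is computed by the jump of `X`. -/
theorem setTuringReducible_turingJump {X Y A : Set ℕ} (hY : SetTuringReducible Y X)
    (hA : ∀ a, a ∈ A ↔ ∃ x, Nat.pair a x ∉ Y) : SetTuringReducible A (turingJump X) := by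
  unfold SetTuringReducible TuringReducible at hY
  rw [RecursiveIn.iff_nat] at hY
  obtain ⟨e, he⟩ := OracleCode.exists_ofNat_iff.1 hY.rfind
  -- Programs with a constant value, used to build the input `a` into a program.
  let numeral : ℕ → OracleCode := fun n =>
    Nat.rec OracleCode.zero (fun _ c => OracleCode.comp OracleCode.succ c) n
  have hnum : ∀ g n m, (numeral n).eval g m = Part.some n := by
    intro g n m
    induction n with
    | zero => rfl
    | succ n ih =>
      change (numeral n).eval g m >>= OracleCode.eval g OracleCode.succ = _
      rw [ih]
      simp [OracleCode.eval]
  have henc : Computable fun n => (numeral n).encode := by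
    have h4 : Computable fun x : ℕ => 4 * x + 6 :=
      Primrec.to_comp (Primrec.nat_add.comp (Primrec.nat_mul.comp (.const 4) .id) (.const 6))
    -- `4 * Nat.pair 1 t + 6` is the number of `comp succ c` if `t` is the number of `c`.
    refine (Computable.nat_rec (f := fun n : ℕ => n) (g := fun _ => 0)
      (h := fun _ y => 4 * Nat.pair 1 y.2 + 6) Computable.id (Computable.const 0)
      (h4.comp (Computable.natPair (Computable.const 1)
        (Computable.snd.comp Computable.snd)))).of_eq fun n => ?_
    induction n with
    | zero => rfl
    | succ n ih => exact congrArg (fun t => 4 * Nat.pair 1 t + 6) ih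
  -- On every input, in particular on its own number, this program runs the search at `a`; so it
  -- halts there exactly when `a ∈ A`.
  let s : ℕ → ℕ := fun a => (OracleCode.comp (OracleCode.ofNat e) (numeral a)).encode
  have hs : Computable s := by
    have h4 : Computable fun x : ℕ => 4 * x + 6 :=
      Primrec.to_comp (Primrec.nat_add.comp (Primrec.nat_mul.comp (.const 4) .id) (.const 6))
    exact h4.comp (Computable.natPair (Computable.const (OracleCode.ofNat e).encode) henc)
  refine .of_iff hs fun a => ?_
  change _ ↔ ((OracleCode.ofNat (s a)).eval (charFun X) (s a)).Dom
  rw [OracleCode.ofNat_encode]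
  change _ ↔ ((numeral a).eval (charFun X) (s a) >>= (OracleCode.ofNat e).eval (charFun X)).Dom
  rw [hnum, he, hA]
  refine Iff.trans ?_ (iff_of_eq (congrArg Part.Dom (Part.bind_some _ _))).symm
  refine Iff.trans ?_ (rfind_zero_dom_iff fun _ => trivial).symm
  simp only [charFun_eq_zero]

/-- Diagonalization: if `X` decided its jump, some program would halt on `n` exactly when `n` is
outside the jump. Its own number gives the contradiction. -/
theorem turingJump_not_le (X : Set ℕ) : ¬ SetTuringReducible (turingJump X) X := by
  intro h
  unfold SetTuringReducible TuringReducible at h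
  rw [RecursiveIn.iff_nat] at h
  have hfst : Computable fun n : ℕ => n.unpair.1 := Computable.unpair_fst Computable.id
  -- The tested value does not depend on the search variable, so the search stops at once or never.
  obtain ⟨e, he⟩ := OracleCode.exists_ofNat_iff.1
    (h.comp (Partrec.nat_iff.1 hfst).recursiveIn).rfind
  have key : e ∈ turingJump X ↔ e ∉ turingJump X := by
    change ((OracleCode.ofNat e).eval (charFun X) e).Dom ↔ _
    rw [he]
    have hb : (Part.some e).bind (charFun (turingJump X)) = charFun (turingJump X) e :=
      Part.bind_some _ _
    refine (rfind_zero_dom_iff fun n => ?_).trans ?_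
    · exact ⟨trivial, trivial⟩
    · change (∃ n, 0 ∈ (Part.some (Nat.pair e n).unpair.1).bind (charFun (turingJump X))) ↔ _
      simp only [Nat.unpair_pair, exists_const]
      rw [hb, charFun_eq_zero]
  exact iff_not_self key

/-- The `n`-th Turing jump of the empty set. -/
def zeroJump (n : ℕ) : Set ℕ := turingJump^[n] ∅

/-- One direction of Post's theorem: each quantifier costs one jump. -/
theorem ArithSigma.le_zeroJump {n : ℕ} {A : Set ℕ} (hA : ArithSigma n fun a => a ∈ A) :
    SetTuringReducible A (zeroJump n) := by
  induction n generalizing A with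
  | zero =>
    unfold SetTuringReducible
    refine Partrec.turingReducible ?_
    obtain ⟨_, h⟩ := hA
    refine Computable.partrec ((Computable.cond h (Computable.const 1) (Computable.const 0)).of_eq
      fun n => ?_)
    by_cases hn : n ∈ A <;> simp [hn]
  | succ n ih =>
    obtain ⟨B, hB, h⟩ := isSigma0_iff.2 hA
    unfold zeroJump
    rw [Function.iterate_succ_apply']
    exact setTuringReducible_turingJump (ih (isSigma0_iff.1 hB)) h

theorem ArithPi.le_zeroJump {n : ℕ} {A : Set ℕ} (hA : ArithPi n fun a => a ∈ A) :
    SetTuringReducible A (zeroJump n) := by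
  simpa using (ArithSigma.le_zeroJump (A := Aᶜ) hA).compl

/-! ### The second jump is `Σ⁰₂` -/

namespace OracleCode

/-- The ordinary program obtained from an oracle program by substituting the program `o` for the
oracle. -/
def toCode (o : Code) : OracleCode → Code
  | zero => .zero
  | succ => .succ
  | left => .left
  | right => .right
  | oracle => o
  | pair cf ch => .pair (toCode o cf) (toCode o ch)
  | comp cf ch => .comp (toCode o cf) (toCode o ch)
  | prec cf ch => .prec (toCode o cf) (toCode o ch)
  -- `rfind'` starts its search at the second component of the input, which is set to 0.
  | rfind cf => .comp (.rfind' (toCode o cf)) (.pair .id .zero)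

theorem eval_toCode (o : Code) (c : OracleCode) : (toCode o c).eval = c.eval o.eval := by
  induction c with
  | zero | succ | left | right | oracle => rfl
  | pair cf ch ihf ihh =>
    simp only [toCode, Code.eval, eval, ihf, ihh]
    rfl
  | comp cf ch ihf ihh =>
    simp only [toCode, Code.eval, eval, ihf, ihh]
    rfl
  | prec cf ch ihf ihh =>
    simp only [toCode, Code.eval, eval, ihf, ihh]
    rfl
  | rfind cf ih =>
    funext n
    have hz : Code.eval .zero n = Part.some 0 := rfl
    simp only [toCode, Code.eval, eval, ih, Code.eval_id]
    simp [Seq.seq, Part.map_id', pure, PFun.pure]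

/-- Course-of-values recursion on the Gödel number of the oracle program. -/
theorem toCode_computable : Computable₂ fun (o : Code) (e : ℕ) => toCode o (ofNat e) := by
  -- `l` lists the translations of all programs with smaller numbers, so `l.length` is the number of
  -- the program being translated.
  let g : Code → List Code → Option Code := fun o l =>
    bif decide (l.length < 5) then ([Code.zero, .succ, .left, .right, o] : List Code)[l.length]?
    else
      (l[((l.length - 5) / 4).unpair.1]?).bind fun a =>
      (l[((l.length - 5) / 4).unpair.2]?).bind fun b =>
      (l[(l.length - 5) / 4]?).map fun c =>
        bif decide ((l.length - 5) % 4 = 0) then Code.pair a b else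
        bif decide ((l.length - 5) % 4 = 1) then Code.comp a b else
        bif decide ((l.length - 5) % 4 = 2) then Code.prec a b else
        Code.comp (.rfind' c) (.pair .id .zero)
  have hlen : Primrec fun x : Code × List Code => x.2.length :=
    Primrec.list_length.comp Primrec.snd
  have hdiv : Primrec fun x : Code × List Code => (x.2.length - 5) / 4 :=
    Primrec.nat_div.comp (Primrec.nat_sub.comp hlen (.const 5)) (.const 4)
  have hmod : Primrec fun x : Code × List Code => (x.2.length - 5) % 4 :=
    Primrec.nat_mod.comp (Primrec.nat_sub.comp hlen (.const 5)) (.const 4)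
  have hu1 : Primrec fun x : Code × List Code => ((x.2.length - 5) / 4).unpair.1 :=
    Primrec.fst.comp (Primrec.unpair.comp hdiv)
  have hu2 : Primrec fun x : Code × List Code => ((x.2.length - 5) / 4).unpair.2 :=
    Primrec.snd.comp (Primrec.unpair.comp hdiv)
  have hl : Primrec fun x : Code × List Code =>
      ([Code.zero, .succ, .left, .right, x.1] : List Code) :=
    Primrec.list_cons.comp (.const _) <| Primrec.list_cons.comp (.const _) <|
      Primrec.list_cons.comp (.const _) <| Primrec.list_cons.comp (.const _) <|
      Primrec.list_cons.comp .fst (.const _)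
  have hg : Primrec₂ g := by
    refine Primrec.cond (Primrec.nat_lt.decide.comp hlen (.const 5))
      (Primrec.list_getElem?.comp hl hlen) ?_
    refine Primrec.option_bind (Primrec.list_getElem?.comp .snd hu1) ?_
    refine Primrec.option_bind (Primrec.list_getElem?.comp (Primrec.snd.comp .fst)
      (hu2.comp .fst)) ?_
    refine Primrec.option_map (Primrec.list_getElem?.comp (Primrec.snd.comp (Primrec.fst.comp .fst))
      (hdiv.comp (Primrec.fst.comp .fst))) ?_
    have hm : Primrec fun x : (((Code × List Code) × Code) × Code) × Code =>
        (x.1.1.1.2.length - 5) % 4 := hmod.comp (Primrec.fst.comp (Primrec.fst.comp .fst))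
    have ha : Primrec fun x : (((Code × List Code) × Code) × Code) × Code => x.1.1.2 :=
      Primrec.snd.comp (Primrec.fst.comp .fst)
    have hb : Primrec fun x : (((Code × List Code) × Code) × Code) × Code => x.1.2 :=
      Primrec.snd.comp .fst
    refine Primrec.cond (Primrec.eq.decide.comp hm (.const 0)) (Code.primrec₂_pair.comp ha hb) ?_
    refine Primrec.cond (Primrec.eq.decide.comp hm (.const 1)) (Code.primrec₂_comp.comp ha hb) ?_
    refine Primrec.cond (Primrec.eq.decide.comp hm (.const 2)) (Code.primrec₂_prec.comp ha hb) ?_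
    exact Code.primrec₂_comp.comp (Code.primrec_rfind'.comp .snd) (.const _)
  refine Computable.nat_strong_rec _ hg.to_comp fun o n => ?_
  simp only [g, List.length_map, List.length_range]
  by_cases hn : n < 5
  · interval_cases n <;> simp [ofNat, toCode]
  · obtain ⟨m, rfl⟩ : ∃ m, n = m + 5 := ⟨n - 5, by omega⟩
    have h1 : (m / 4).unpair.1 < m + 5 := by
      have := Nat.unpair_left_le (m / 4); omega
    have h2 : (m / 4).unpair.2 < m + 5 := by
      have := Nat.unpair_right_le (m / 4); omega
    have h3 : m / 4 < m + 5 := by omega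
    have h4 : m % 4 < 4 := Nat.mod_lt _ (by omega)
    rw [ofNat]
    simp only [Nat.add_sub_cancel, List.getElem?_map, List.getElem?_range h1,
      List.getElem?_range h2, List.getElem?_range h3, hn, decide_false, cond_false,
      Option.map_some, Option.bind_some]
    generalize m % 4 = r at *
    interval_cases r <;> simp [toCode]

/-! ### Monotonicity in the oracle and the use principle -/

theorem mem_eval_comp {g : ℕ →. ℕ} {cf ch : OracleCode} {n y : ℕ} :
    y ∈ (comp cf ch).eval g n ↔ ∃ a ∈ ch.eval g n, y ∈ cf.eval g a :=
  Part.mem_bind_iff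

theorem mem_eval_pair {g : ℕ →. ℕ} {cf ch : OracleCode} {n y : ℕ} :
    y ∈ (pair cf ch).eval g n ↔ ∃ a ∈ cf.eval g n, ∃ b ∈ ch.eval g n, Nat.pair a b = y := by
  simp [eval, Seq.seq, Part.mem_bind_iff, Part.mem_map_iff]

theorem mem_eval_rfind {g : ℕ →. ℕ} {cf : OracleCode} {n y : ℕ} :
    y ∈ (rfind cf).eval g n ↔ 0 ∈ cf.eval g (Nat.pair n y) ∧
      ∀ m < y, ∃ b ∈ cf.eval g (Nat.pair n m), b ≠ 0 := by
  refine Nat.mem_rfind.trans (and_congr ((Part.mem_map_iff _).trans ?_) ?_)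
  · simp
  · refine forall_congr' fun m => forall_congr' fun _ => (Part.mem_map_iff _).trans ?_
    simp

theorem mem_eval_mono {g g' : ℕ →. ℕ} (h : ∀ n y, y ∈ g n → y ∈ g' n) (c : OracleCode) :
    ∀ n y, y ∈ c.eval g n → y ∈ c.eval g' n := by
  induction c with
  | zero | succ | left | right => exact fun _ _ h => h
  | oracle => exact h
  | pair cf ch ihf ihh =>
    intro n y hy
    rw [mem_eval_pair] at hy ⊢
    obtain ⟨a, ha, b, hb, rfl⟩ := hy
    exact ⟨a, ihf _ _ ha, b, ihh _ _ hb, rfl⟩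
  | comp cf ch ihf ihh =>
    intro n y hy
    simp only [mem_eval_comp] at hy ⊢
    obtain ⟨a, ha, hy⟩ := hy
    exact ⟨a, ihh _ _ ha, ihf _ _ hy⟩
  | prec cf ch ihf ihh =>
    intro n y hy
    simp only [eval] at hy ⊢
    generalize n.unpair.2 = k at *
    induction k generalizing y with
    | zero => exact ihf _ _ hy
    | succ k ih =>
      simp only [Part.bind_eq_bind, Part.mem_bind_iff] at hy ⊢
      obtain ⟨a, ha, hy⟩ := hy
      exact ⟨a, ih _ ha, ihh _ _ hy⟩
  | rfind cf ih =>
    intro n y hy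
    rw [mem_eval_rfind] at hy ⊢
    refine ⟨ih _ _ hy.1, fun m hm => ?_⟩
    obtain ⟨b, hb, h1⟩ := hy.2 m hm
    exact ⟨b, ih _ _ hb, h1⟩

/-- The use principle: a converging oracle computation uses only one member of an increasing
sequence of approximations to the oracle. -/
theorem exists_mem_eval {g : ℕ →. ℕ} {G : ℕ → ℕ →. ℕ}
    (hmono : ∀ i j, i ≤ j → ∀ n y, y ∈ G i n → y ∈ G j n)
    (hG : ∀ n y, y ∈ g n → ∃ i, y ∈ G i n) (c : OracleCode) :
    ∀ n y, y ∈ c.eval g n → ∃ i, y ∈ c.eval (G i) n := by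
  have up : ∀ (c : OracleCode) {i j n y}, i ≤ j → y ∈ c.eval (G i) n → y ∈ c.eval (G j) n :=
    fun c _ _ _ _ hij => mem_eval_mono (hmono _ _ hij) c _ _
  induction c with
  | zero | succ | left | right => exact fun _ _ h => ⟨0, h⟩
  | oracle => exact hG
  | pair cf ch ihf ihh =>
    intro n y hy
    simp only [mem_eval_pair] at hy ⊢
    obtain ⟨a, ha, b, hb, rfl⟩ := hy
    obtain ⟨i, hi⟩ := ihf _ _ ha
    obtain ⟨j, hj⟩ := ihh _ _ hb
    exact ⟨max i j, a, up _ (le_max_left _ _) hi, b, up _ (le_max_right _ _) hj, rfl⟩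
  | comp cf ch ihf ihh =>
    intro n y hy
    simp only [mem_eval_comp] at hy ⊢
    obtain ⟨a, ha, hy⟩ := hy
    obtain ⟨i, hi⟩ := ihh _ _ ha
    obtain ⟨j, hj⟩ := ihf _ _ hy
    exact ⟨max i j, a, up _ (le_max_left _ _) hi, up _ (le_max_right _ _) hj⟩
  | prec cf ch ihf ihh =>
    intro n y hy
    suffices H : ∃ i, ∃ j ≥ i, y ∈ (prec cf ch).eval (G j) n from by
      obtain ⟨_, j, _, h⟩ := H
      exact ⟨j, h⟩
    -- The induction on the recursion variable compares stages of the unfolded recursion, to which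
    -- `up` does not apply; hence convergence is claimed at all stages from `i` on.
    suffices H : ∃ i, ∀ j ≥ i, y ∈ (prec cf ch).eval (G j) n from by
      obtain ⟨i, h⟩ := H
      exact ⟨i, i, le_rfl, h i le_rfl⟩
    simp only [eval] at hy ⊢
    generalize n.unpair.2 = k at *
    induction k generalizing y with
    | zero =>
      obtain ⟨i, hi⟩ := ihf _ _ hy
      exact ⟨i, fun j hj => up _ hj hi⟩
    | succ k ih =>
      simp only [Part.bind_eq_bind, Part.mem_bind_iff] at hy ⊢
      obtain ⟨a, ha, hy⟩ := hy
      obtain ⟨i, hi⟩ := ih _ ha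
      obtain ⟨j, hj⟩ := ihh _ _ hy
      exact ⟨max i j, fun l hl => ⟨a, hi _ (le_of_max_le_left hl),
        up _ (le_of_max_le_right hl) hj⟩⟩
  | rfind cf ih =>
    intro n y hy
    simp only [mem_eval_rfind] at hy ⊢
    obtain ⟨ha, hlt⟩ := hy
    obtain ⟨i, hi⟩ := ih _ _ ha
    have H : ∀ m : ℕ, ∃ j, m < y →
        ∃ b ∈ cf.eval (G j) (Nat.pair n m), b ≠ 0 := by
      intro m
      by_cases hm : m < y
      · obtain ⟨b, hb, h1⟩ := hlt m hm
        obtain ⟨j, hj⟩ := ih _ _ hb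
        exact ⟨j, fun _ => ⟨b, hj, h1⟩⟩
      · exact ⟨0, fun h => absurd h hm⟩
    choose J hJ using H
    -- A stage that serves the successful test at `y` and the finitely many failed tests below it.
    refine ⟨max i ((Finset.range y).sup J), up _ (le_max_left _ _) hi, fun m hm => ?_⟩
    obtain ⟨b, hb, h1⟩ := hJ m hm
    exact ⟨b, up _ ((Finset.le_sup (f := J) (Finset.mem_range.2 hm)).trans (le_max_right _ _)) hb,
      h1⟩

end OracleCode

/-! ### Finite approximations and the complexity of the first two jumps -/

theorem code_eval_dom_iff (c : Code) (n : ℕ) :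
    (c.eval n).Dom ↔ ∃ s, (c.evaln s n).isSome = true := by
  simp only [Part.dom_iff_mem, Code.evaln_complete, Option.isSome_iff_exists, Option.mem_def]
  exact exists_comm

theorem arithSigma_code_eval_dom {α : Type} [Primcodable α] {c : α → Code} {n : α → ℕ}
    (hc : Computable c) (hn : Computable n) : ArithSigma 1 fun a => ((c a).eval (n a)).Dom := by
  have h : ComputablePred fun y : α × ℕ => ((c y.1).evaln y.2 (n y.1)).isSome = true :=
    Computable.eq_pred (Primrec.option_isSome.to_comp.comp (Code.primrec_evaln.to_comp.comp
      ((Computable.snd.pair (hc.comp Computable.fst)).pair (hn.comp Computable.fst))))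
      (Computable.const true)
  exact (ArithSigma.exists_nat h.arithSigma).of_iff fun a => code_eval_dom_iff _ _

/-- The element `e` enters the jump of the empty set by stage `s`. -/
def EntersJump (e s : ℕ) : Prop :=
  ((OracleCode.toCode .zero (OracleCode.ofNat e)).evaln s e).isSome = true

theorem entersJump_computable : ComputablePred fun y : ℕ × ℕ => EntersJump y.1 y.2 :=
  Computable.eq_pred (Primrec.option_isSome.to_comp.comp (Code.primrec_evaln.to_comp.comp
    ((Computable.snd.pair (OracleCode.toCode_computable.comp (Computable.const Code.zero)
      Computable.fst)).pair Computable.fst))) (Computable.const true)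

theorem mem_turingJump_empty {e : ℕ} : e ∈ turingJump ∅ ↔ ∃ s, EntersJump e s := by
  have h : charFun ∅ = Code.eval .zero := by
    funext n
    simp only [charFun, Set.indicator_empty]
    rfl
  change ((OracleCode.ofNat e).eval (charFun ∅) e).Dom ↔ _
  rw [h, ← OracleCode.eval_toCode]
  exact code_eval_dom_iff _ _

theorem arithSigma_turingJump_empty : ArithSigma 1 fun e => e ∈ turingJump ∅ :=
  (ArithSigma.exists_nat entersJump_computable.arithSigma).of_iff fun _ => mem_turingJump_empty

/-- A finite list acts as a partial oracle that is undefined beyond its length. An entry 0 answers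
"no", and a nonzero entry answers "yes" while its value carries evidence; `min v 1` discards the
evidence. -/
theorem exists_lookupCode : ∃ c : Code, ∀ (u : List ℕ) (i : ℕ),
    (c.curry (Encodable.encode u)).eval i = ((u[i]?).map fun v => min v 1 : Option ℕ) := by
  have h : Partrec fun z : ℕ =>
      (((Denumerable.ofNat (List ℕ) z.unpair.1)[z.unpair.2]?).map fun v => min v 1 : Part ℕ) := by
    refine (Computable.ofOption ?_ : Partrec fun z : ℕ =>
      ((((Denumerable.ofNat (List ℕ) z.unpair.1)[z.unpair.2]?).map fun v => min v 1 : Option ℕ) :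
        Part ℕ)).of_eq fun z => ?_
    · exact Computable.option_map (Computable.list_getElem?.comp
        ((Computable.ofNat _).comp (Computable.unpair_fst Computable.id))
        (Computable.unpair_snd Computable.id))
        (Primrec.nat_min.to_comp.comp Computable.snd (Computable.const 1))
    · cases (Denumerable.ofNat (List ℕ) z.unpair.1)[z.unpair.2]? <;> simp
  obtain ⟨c, hc⟩ := Code.exists_code.1 (Partrec.nat_iff.1 h)
  refine ⟨c, fun u i => ?_⟩
  rw [Code.eval_curry, hc]
  simp only [Nat.unpair_pair, Denumerable.ofNat_encode]

/-- By the use principle, `e` is in the second jump iff its program halts when the oracle is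
replaced by some finite list of correct answers about the first jump. Positive answers name a stage
of entry, so correctness of a list is `Π⁰₁`, and halting relative to a list is `Σ⁰₁`. -/
theorem arithSigma_turingJump_turingJump :
    ArithSigma 2 fun e => e ∈ turingJump (turingJump ∅) := by
  classical
  obtain ⟨L, hL⟩ := exists_lookupCode
  let correct : List ℕ → Prop := fun u => ∀ i v, ¬ (u[i]? = some v) ∨
    ((v = 0 ∧ i ∉ turingJump ∅) ∨ (v ≠ 0 ∧ EntersJump i (v - 1)))
  have hcorrect : ArithPi 1 correct := by
    refine ArithPi.forall_nat (p := fun y : List ℕ × ℕ => ∀ v, ¬ (y.1[y.2]? = some v) ∨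
      ((v = 0 ∧ y.2 ∉ turingJump ∅) ∨ (v ≠ 0 ∧ EntersJump y.2 (v - 1)))) ?_
    refine ArithPi.forall_nat (p := fun y : (List ℕ × ℕ) × ℕ => ¬ (y.1.1[y.1.2]? = some y.2) ∨
      ((y.2 = 0 ∧ y.1.2 ∉ turingJump ∅) ∨ (y.2 ≠ 0 ∧ EntersJump y.1.2 (y.2 - 1)))) ?_
    have h2 : Computable fun y : (List ℕ × ℕ) × ℕ => y.1.2 := Computable.snd.comp Computable.fst
    refine ArithPi.or ?_ (ArithPi.or (ArithPi.and ?_ ?_) ?_)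
    · exact (Computable.eq_pred (Computable.list_getElem?.comp
        (Computable.fst.comp Computable.fst) h2)
        (Computable.option_some.comp Computable.snd)).not.arithPi
    · exact (Computable.eq_pred Computable.snd (Computable.const 0)).arithPi
    · exact (arithSigma_turingJump_empty.comp h2).not
    · exact ((Computable.eq_pred Computable.snd (Computable.const 0)).not.and
        (entersJump_computable.comp (h2.pair
          (Computable.pred.comp Computable.snd)))).arithPi
  have hmem : ∀ e, e ∈ turingJump (turingJump ∅) ↔ ∃ u : List ℕ, correct u ∧
      ((OracleCode.toCode (L.curry (Encodable.encode u)) (OracleCode.ofNat e)).eval e).Dom := by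
    intro e
    change ((OracleCode.ofNat e).eval (charFun (turingJump ∅)) e).Dom ↔ _
    simp only [OracleCode.eval_toCode]
    constructor
    · intro he
      obtain ⟨y, hy⟩ := Part.dom_iff_mem.1 he
      have H : ∀ i, ∃ v, (v = 0 ∧ i ∉ turingJump ∅) ∨ (v ≠ 0 ∧ EntersJump i (v - 1)) := by
        intro i
        by_cases hi : i ∈ turingJump ∅
        · obtain ⟨s, hs⟩ := mem_turingJump_empty.1 hi
          exact ⟨s + 1, Or.inr ⟨by simp, by simpa using hs⟩⟩
        · exact ⟨0, Or.inl ⟨rfl, hi⟩⟩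
      choose v hv using H
      have hvmem : ∀ i, charFun (turingJump ∅) i = Part.some (min (v i) 1) := by
        intro i
        rcases hv i with ⟨h0, hi⟩ | ⟨h0, hi⟩
        · simp [charFun, hi, h0]
        · have : i ∈ turingJump ∅ := mem_turingJump_empty.2 ⟨_, hi⟩
          have h1 : min (v i) 1 = 1 := by omega
          simp [charFun, this, h1]
      let u : ℕ → List ℕ := fun N => (List.range N).map v
      have hu : ∀ N i w, (u N)[i]? = some w ↔ i < N ∧ w = v i := by
        intro N i w
        simp only [u, List.getElem?_map, Option.map_eq_some_iff, List.getElem?_eq_some_iff]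
        simp
        grind
      have hLu : ∀ N i y, y ∈ (L.curry (Encodable.encode (u N))).eval i ↔
          i < N ∧ y = min (v i) 1 := by
        intro N i y
        rw [hL, Part.mem_coe, Option.mem_def, Option.map_eq_some_iff]
        constructor
        · rintro ⟨w, hw, rfl⟩
          obtain ⟨h1, rfl⟩ := (hu _ _ _).1 hw
          exact ⟨h1, rfl⟩
        · rintro ⟨h1, rfl⟩
          exact ⟨v i, (hu _ _ _).2 ⟨h1, rfl⟩, rfl⟩
      obtain ⟨N, hN⟩ := OracleCode.exists_mem_eval
        (G := fun N => (L.curry (Encodable.encode (u N))).eval)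
        (fun i j hij n y h => (hLu _ _ _).2 ⟨((hLu _ _ _).1 h).1.trans_le hij, ((hLu _ _ _).1 h).2⟩)
        (fun n y h => ⟨n + 1, (hLu _ _ _).2 ⟨n.lt_succ_self, by
          rw [hvmem] at h; exact Part.mem_some_iff.1 h⟩⟩) _ _ _ hy
      refine ⟨u N, fun i w => or_iff_not_imp_left.2 fun h => ?_, Part.dom_iff_mem.2 ⟨y, hN⟩⟩
      obtain ⟨-, rfl⟩ := (hu _ _ _).1 (not_not.1 h)
      exact hv i
    · rintro ⟨u, hu, he⟩
      obtain ⟨y, hy⟩ := Part.dom_iff_mem.1 he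
      refine Part.dom_iff_mem.2 ⟨y, OracleCode.mem_eval_mono (fun i w hw => ?_) _ _ _ hy⟩
      rw [hL, Part.mem_coe, Option.mem_def, Option.map_eq_some_iff] at hw
      obtain ⟨v, hv, rfl⟩ := hw
      rcases (hu i v).resolve_left (not_not.2 hv) with ⟨h0, hi⟩ | ⟨h0, hi⟩
      · simp [charFun, hi, h0]
      · have : i ∈ turingJump ∅ := mem_turingJump_empty.2 ⟨_, hi⟩
        have h1 : min v 1 = 1 := by omega
        simp [charFun, this, h1]
  refine (ArithSigma.exists_denumerable (p := fun y : ℕ × List ℕ => correct y.2 ∧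
    ((OracleCode.toCode (L.curry (Encodable.encode y.2)) (OracleCode.ofNat y.1)).eval y.1).Dom)
    ?_).of_iff hmem
  refine (hcorrect.comp Computable.snd).sigma_succ.and ?_
  refine ArithSigma.succ (arithSigma_code_eval_dom ?_ Computable.fst)
  exact OracleCode.toCode_computable.comp (Code.primrec₂_curry.to_comp.comp (Computable.const L)
    (Computable.encode.comp Computable.snd)) Computable.fst

/-! ### Greedy constructions -/

/-- The first `n` values of the sequence that is built greedily: the next value is the least one
that stands in the relation `P` to the list of the values chosen so far. -/
noncomputable def greedyHistory (P : List ℕ × ℕ → Prop) : ℕ → List ℕ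
  | 0 => []
  | n + 1 => greedyHistory P n ++ [sInf {v | P (greedyHistory P n, v)}]

/-- The sequence that is built greedily. -/
noncomputable def greedy (P : List ℕ × ℕ → Prop) (n : ℕ) : ℕ :=
  sInf {v | P (greedyHistory P n, v)}

theorem greedyHistory_eq (P : List ℕ × ℕ → Prop) (n : ℕ) :
    greedyHistory P n = (List.range n).map (greedy P) := by
  induction n with
  | zero => rfl
  | succ n ih =>
    rw [List.range_succ, List.map_append, ← ih]
    rfl

theorem greedyHistory_getD (P : List ℕ × ℕ → Prop) {m n : ℕ} (h : m < n) :
    (greedyHistory P n).getD m 0 = greedy P m := by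
  simp [greedyHistory_eq, List.getD_eq_getElem?_getD, h]

theorem greedyHistory_length (P : List ℕ × ℕ → Prop) (n : ℕ) :
    (greedyHistory P n).length = n := by
  simp [greedyHistory_eq]

/-- Each value is found by an unbounded search that `X` can carry out, and the histories are coded
by numbers and built by primitive recursion. -/
theorem greedy_recursiveIn {X : Set ℕ} {P : List ℕ × ℕ → Prop}
    (hP : SetTuringReducible {z | P (Denumerable.ofNat (List ℕ) z.unpair.1, z.unpair.2)} X)
    (hex : ∀ n, ∃ v, P (greedyHistory P n, v)) :
    Nat.RecursiveIn {charFun X} fun n => Part.some (greedy P n) := by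
  set Y : Set ℕ := {z | P (Denumerable.ofNat (List ℕ) z.unpair.1, z.unpair.2)}ᶜ with hYdef
  have hY : SetTuringReducible Y X := hP.compl
  unfold SetTuringReducible TuringReducible at hY
  rw [RecursiveIn.iff_nat] at hY
  let S : ℕ →. ℕ := fun L =>
    Nat.rfind fun v => (fun m => decide (m = 0)) <$> charFun Y (Nat.pair L v)
  have hS : Nat.RecursiveIn {charFun X} S := hY.rfind
  have hYmem : ∀ l v, 0 ∈ charFun Y (Nat.pair (Encodable.encode l) v) ↔ P (l, v) := by
    intro l v
    rw [charFun_eq_zero, hYdef]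
    simp
  have hSval : ∀ n, S (Encodable.encode (greedyHistory P n)) = Part.some (greedy P n) := by
    intro n
    refine Part.eq_some_iff.2 (Nat.mem_rfind.2 ⟨(Part.mem_map_iff _).2 ⟨0, ?_, by simp⟩, ?_⟩)
    · exact (hYmem _ _).2 (Nat.sInf_mem (hex n))
    · intro m hm
      refine (Part.mem_map_iff _).2 ⟨_, Part.get_mem trivial, ?_⟩
      refine decide_eq_false fun h0 => Nat.notMem_of_lt_sInf hm ((hYmem _ _).1 ?_)
      rw [← h0]
      exact Part.get_mem _
  let app : ℕ → ℕ := fun z =>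
    Encodable.encode (Denumerable.ofNat (List ℕ) z.unpair.1 ++ [z.unpair.2])
  have happ : Computable app := Computable.encode.comp (Computable.list_concat.comp
    ((Computable.ofNat _).comp (Computable.unpair_fst Computable.id))
    (Computable.unpair_snd Computable.id))
  have hproj : Computable fun z : ℕ => z.unpair.2.unpair.2 :=
    Computable.unpair_snd (Computable.unpair_snd Computable.id)
  have hid : Nat.RecursiveIn {charFun X} fun z : ℕ => Part.some z :=
    (Partrec.nat_iff.1 Computable.id.partrec).recursiveIn
  -- In the primitive recursion `z` codes a dummy parameter, the index and the history so far; only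
  -- the history is used.
  have hstep : Nat.RecursiveIn {charFun X} fun z : ℕ =>
      (S z.unpair.2.unpair.2).map fun v => app (Nat.pair z.unpair.2.unpair.2 v) := by
    refine (((Partrec.nat_iff.1 happ).recursiveIn.comp (hid.pair hS)).comp
      (Partrec.nat_iff.1 hproj).recursiveIn).of_eq fun z => ?_
    refine (Part.bind_some _ _).trans ?_
    refine Part.ext fun y => Part.mem_bind_iff.trans (Iff.trans ?_ (Part.mem_map_iff _).symm)
    simp [Seq.seq, eq_comm]
  have hzero : Nat.RecursiveIn {charFun X} fun _ => Part.some 0 := .zero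
  have hH := hzero.prec hstep
  have hpair : Computable fun n : ℕ => Nat.pair 0 n :=
    Computable.natPair (Computable.const 0) Computable.id
  refine (hS.comp (hH.comp (Partrec.nat_iff.1 hpair).recursiveIn)).of_eq fun n => ?_
  refine Eq.trans ?_ (hSval n)
  refine Eq.trans ?_ (Part.bind_some (Encodable.encode (greedyHistory P n)) S)
  refine congrArg (Part.bind · S) ?_
  refine (Part.bind_some _ _).trans ?_
  simp only [Nat.unpair_pair]
  induction n with
  | zero => simp [greedyHistory]
  | succ n ih =>
    simp only at ih ⊢
    rw [ih]
    refine (Part.bind_some _ _).trans ?_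
    simp only [Nat.unpair_pair, hSval, Part.map_some, app, Denumerable.ofNat_encode]
    rfl

/-! ### Partial equivalence relations on the natural numbers -/

/-- A symmetric and transitive relation: an equivalence relation on its domain
`{n | R n n}`. -/
structure IsPER (R : ℕ → ℕ → Prop) : Prop where
  symm : ∀ {x y}, R x y → R y x
  trans : ∀ {x y z}, R x y → R y z → R x z

namespace IsPER

variable {R : ℕ → ℕ → Prop}

theorem left (h : IsPER R) {x y : ℕ} (hxy : R x y) : R x x := h.trans hxy (h.symm hxy)

theorem congr_right (h : IsPER R) {x y z : ℕ} (hyz : R y z) : R x y ↔ R x z :=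
  ⟨fun hxy => h.trans hxy hyz, fun hxz => h.trans hxz (h.symm hyz)⟩

end IsPER

/-- The number of elements of the class of `n`. -/
noncomputable def classCard (R : ℕ → ℕ → Prop) (n : ℕ) : ℕ∞ := {k | R k n}.encard

theorem IsPER.classCard_eq {R : ℕ → ℕ → Prop} (h : IsPER R) {m n : ℕ} (hmn : R m n) :
    classCard R m = classCard R n := by
  unfold classCard
  congr 1
  ext k
  exact h.congr_right hmn

/-- There are infinitely many classes that have at least `κ` elements. -/
def ManyClasses (R : ℕ → ℕ → Prop) (κ : ℕ∞) : Prop :=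
  ∀ F : Finset ℕ, ∃ y, R y y ∧ (∀ s ∈ F, ¬ R s y) ∧ κ ≤ classCard R y

/-- The map `f` embeds the restriction of `R` to `{n | p n}` in `S`. -/
def EmbedsOn (R S : ℕ → ℕ → Prop) (p : ℕ → Prop) (f : ℕ → ℕ) : Prop :=
  ∀ m n, p m → p n → R m m → R n n → (R m n ↔ S (f m) (f n)) ∧ (f m = f n → m = n)

theorem EmbedsOn.classCard_le {R S : ℕ → ℕ → Prop} (hR : IsPER R) {f : ℕ → ℕ}
    (hf : EmbedsOn R S (fun _ => True) f) {n : ℕ} (hn : R n n) :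
    classCard R n ≤ classCard S (f n) := by
  unfold classCard
  rw [← (show Set.InjOn f {k | R k n} from fun a ha b hb hab =>
    (hf a b trivial trivial (hR.left ha) (hR.left hb)).2 hab).encard_image]
  refine Set.encard_le_encard ?_
  rintro _ ⟨k, hk, rfl⟩
  exact (hf k n trivial trivial (hR.left hk) hn).1.1 hk

/-- All but finitely many classes of the embedded relation are small enough to be sent to
infinitely many classes. -/
theorem EmbedsOn.exists_bound {R S : ℕ → ℕ → Prop} (hR : IsPER R) (hS : IsPER S) {f : ℕ → ℕ}
    (hf : EmbedsOn R S (fun _ => True) f) :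
    ∃ N, ∀ n, R n n → (∀ m < N, ¬ R m n) → ManyClasses S (classCard R n) := by
  classical
  by_contra! hN
  let T : Set ℕ := {x | R x x ∧ ¬ ManyClasses S (classCard R x)}
  have hT : ∀ N, ∃ x ∈ T, ∀ m < N, ¬ R m x := fun N => by
    obtain ⟨x, h1, h2, h3⟩ := hN N
    exact ⟨x, ⟨h1, h3⟩, h2⟩
  -- Take a bad element whose class is smallest. The bad elements meet infinitely many classes, all
  -- at least that large, and their images are infinitely many classes of `S` that are at least that
  -- large: so `x₀` is not bad.
  obtain ⟨x₀, hx₀, hmin⟩ := WellFounded.has_min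
    (InvImage.wf (classCard R) (wellFounded_lt (α := ℕ∞))) T (by
      obtain ⟨x, hx, -⟩ := hT 0
      exact ⟨x, hx⟩)
  refine hx₀.2 fun F => ?_
  -- At most one class of `R` is sent into the class of `s`; `g s` represents it, with a dummy value
  -- if there is none. Avoiding the classes of the `g s` keeps the image away from `F`.
  have hg : ∀ s, ∃ x, ∀ z, R z z → S s (f z) → R x x ∧ S s (f x) := by
    intro s
    by_cases h : ∃ z, R z z ∧ S s (f z)
    · obtain ⟨z, hz⟩ := h
      exact ⟨z, fun _ _ _ => hz⟩
    · exact ⟨0, fun z h1 h2 => absurd ⟨z, h1, h2⟩ h⟩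
  choose g hg using hg
  obtain ⟨x, hx, hlt⟩ := hT (F.sup g + 1)
  refine ⟨f x, (hf x x trivial trivial hx.1 hx.1).1.1 hx.1, fun s hs hsx => ?_, ?_⟩
  · obtain ⟨h1, h2⟩ := hg s x hx.1 hsx
    exact hlt (g s) (Nat.lt_succ_of_le (Finset.le_sup hs))
      ((hf _ _ trivial trivial h1 hx.1).1.2 (hS.trans (hS.symm h2) hsx))
  · exact (not_lt.1 (hmin x hx)).trans (hf.classCard_le hR hx.1)

/-! ### Greedy embeddings -/

/-- The step of the greedy construction of an embedding of `R` in `S` that extends the first `N`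
values of `e`. The value chosen is a code of the image together with auxiliary data; the condition
`Q` is imposed on the choice of the image of the first element of each class. -/
def EmbeddingStep (R S : ℕ → ℕ → Prop) (e : ℕ → ℕ) (N : ℕ) (Q : ℕ × ℕ → Prop)
    (z : List ℕ × ℕ) : Prop :=
  R z.1.length z.1.length →
    (z.1.length < N ∧ z.2.unpair.1 = e z.1.length) ∨
    (N ≤ z.1.length ∧ S z.2.unpair.1 z.2.unpair.1 ∧
      (∀ m < z.1.length, R m m → (R m z.1.length ↔ S (z.1.getD m 0).unpair.1 z.2.unpair.1) ∧
        (z.1.getD m 0).unpair.1 ≠ z.2.unpair.1) ∧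
      ((∃ m < z.1.length, R m z.1.length) ∨ Q (z.1.length, z.2)))

/-- All clauses other than `Q` are computable, so `Q` alone determines the complexity of a step. -/
theorem EmbeddingStep.arithPi {R S : ℕ → ℕ → Prop} {e : ℕ → ℕ} {N n : ℕ} {Q : ℕ × ℕ → Prop}
    (hR : ComputablePred fun p : ℕ × ℕ => R p.1 p.2)
    (hS : ComputablePred fun p : ℕ × ℕ => S p.1 p.2) (he : Computable e) (hQ : ArithPi n Q) :
    ArithPi n (EmbeddingStep R S e N Q) := by
  have hlen : Computable fun z : List ℕ × ℕ => z.1.length :=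
    Computable.list_length.comp Computable.fst
  have hy : Computable fun z : List ℕ × ℕ => z.2.unpair.1 := Computable.unpair_fst Computable.snd
  have hlen' : Computable fun z : (List ℕ × ℕ) × ℕ => z.1.1.length := hlen.comp Computable.fst
  have hy' : Computable fun z : (List ℕ × ℕ) × ℕ => z.1.2.unpair.1 := hy.comp Computable.fst
  have hget : Computable fun z : (List ℕ × ℕ) × ℕ => (z.1.1.getD z.2 0).unpair.1 :=
    Computable.unpair_fst ((Primrec.list_getD 0).to_comp.comp (Computable.fst.comp Computable.fst)
      Computable.snd)
  refine ArithPi.imp (ComputablePred.arithSigma (hR.comp (hlen.pair hlen))) ?_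
  refine ArithPi.or (ComputablePred.arithPi
    ((Computable.lt_pred hlen (Computable.const N)).and (Computable.eq_pred hy (he.comp hlen)))) ?_
  refine ArithPi.and (Computable.le_pred (Computable.const N) hlen).arithPi ?_
  refine ArithPi.and (hS.comp (hy.pair hy)).arithPi ?_
  refine ArithPi.and (ComputablePred.arithPi ?_) (ArithPi.or (ComputablePred.arithPi ?_) ?_)
  · exact ComputablePred.forall_lt (p := fun z : (List ℕ × ℕ) × ℕ => R z.2 z.2 →
      (R z.2 z.1.1.length ↔ S (z.1.1.getD z.2 0).unpair.1 z.1.2.unpair.1) ∧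
        (z.1.1.getD z.2 0).unpair.1 ≠ z.1.2.unpair.1)
      ((hR.comp (Computable.snd.pair Computable.snd)).imp
        (((hR.comp (Computable.snd.pair hlen')).iff (hS.comp (hget.pair hy'))).and
          (Computable.eq_pred hget hy').not)) hlen
  · exact ComputablePred.exists_lt (p := fun z : (List ℕ × ℕ) × ℕ => R z.2 z.1.1.length)
      (hR.comp (Computable.snd.pair hlen')) hlen
  · exact hQ.comp (hlen.pair Computable.snd)

/-- The hypotheses under which the greedy construction of an embedding succeeds. -/
structure GreedyEmbeddable (R S : ℕ → ℕ → Prop) (e : ℕ → ℕ) (N : ℕ) (Q : ℕ × ℕ → Prop) :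
    Prop where
  left : IsPER R
  right : IsPER S
  embedsOn : EmbedsOn R S (· < N) e
  card_le : ∀ n < N, R n n → classCard R n ≤ classCard S (e n)
  exists_new : ∀ n, N ≤ n → R n n → (∀ m < n, ¬ R m n) → ∀ F : Finset ℕ,
    ∃ v, S v.unpair.1 v.unpair.1 ∧ (∀ s ∈ F, ¬ S s v.unpair.1) ∧ Q (n, v)
  card_le_of : ∀ n v, R n n → Q (n, v) → classCard R n ≤ classCard S v.unpair.1

namespace GreedyEmbeddable

variable {R S : ℕ → ℕ → Prop} {e : ℕ → ℕ} {N : ℕ} {Q : ℕ × ℕ → Prop}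

/-- What the first `n` values of the greedy construction satisfy. -/
structure Invariant (R S : ℕ → ℕ → Prop) (e : ℕ → ℕ) (N n : ℕ) (f : ℕ → ℕ) : Prop where
  embedsOn : EmbedsOn R S (· < n) f
  card_le : ∀ m < n, R m m → classCard R m ≤ classCard S (f m)
  eq : ∀ m < n, m < N → R m m → f m = e m

/-- The greedily constructed embedding. -/
noncomputable def map (R S : ℕ → ℕ → Prop) (e : ℕ → ℕ) (N : ℕ) (Q : ℕ × ℕ → Prop) (n : ℕ) : ℕ :=
  (greedy (EmbeddingStep R S e N Q) n).unpair.1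

theorem step_iff {n v : ℕ} :
    EmbeddingStep R S e N Q (greedyHistory (EmbeddingStep R S e N Q) n, v) ↔
    (R n n → (n < N ∧ v.unpair.1 = e n) ∨
      (N ≤ n ∧ S v.unpair.1 v.unpair.1 ∧
        (∀ m < n, R m m → (R m n ↔ S (map R S e N Q m) v.unpair.1) ∧
          map R S e N Q m ≠ v.unpair.1) ∧
        ((∃ m < n, R m n) ∨ Q (n, v)))) := by
  unfold EmbeddingStep
  simp only [greedyHistory_length]
  refine imp_congr_right fun _ => or_congr_right (and_congr_right fun _ => and_congr_right fun _ =>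
    and_congr_left fun _ => forall_congr' fun m => forall_congr' fun hm => ?_)
  rw [greedyHistory_getD _ hm]
  rfl

/-- The construction never gets stuck. A further element of an old class finds an unused place
because the image class is at least as large as the whole source class; a new class is placed by
`exists_new`, away from all earlier images. -/
theorem exists_step (h : GreedyEmbeddable R S e N Q) {n : ℕ}
    (hn : Invariant R S e N n (map R S e N Q)) :
    ∃ v, EmbeddingStep R S e N Q (greedyHistory (EmbeddingStep R S e N Q) n, v) := by
  simp only [step_iff]
  by_cases hnn : R n n
  swap
  · exact ⟨0, fun h => absurd h hnn⟩
  set f := map R S e N Q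
  rcases lt_or_ge n N with hN | hN
  · exact ⟨Nat.pair (e n) 0, fun _ => Or.inl ⟨hN, by simp⟩⟩
  by_cases hm : ∃ m < n, R m n
  · obtain ⟨m, hmn, hm'⟩ := hm
    have hmm := h.left.left hm'
    -- If the class of `f m` were used up, it would be covered by the images of the elements below
    -- `n` of the class of `m`. These form a finite set that omits `n`, so the class of `f m` would
    -- be strictly smaller than that of `m`.
    have hy : ∃ y, S y (f m) ∧ ∀ k < n, R k k → f k ≠ y := by
      by_contra! hy
      have hsub : {y | S y (f m)} ⊆ f '' {k | k < n ∧ R k m} := by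
        intro y hy'
        obtain ⟨k, hk, hkk, rfl⟩ := hy y hy'
        exact ⟨k, ⟨hk, (hn.embedsOn k m hk hmn hkk hmm).1.2 hy'⟩, rfl⟩
      have hfin : {k | k < n ∧ R k m}.Finite := (Set.finite_lt_nat n).subset fun k hk => hk.1
      have hss : {k | k < n ∧ R k m} ⊂ {k | R k m} :=
        ⟨fun k hk => hk.2, fun hle => lt_irrefl n (hle (h.left.symm hm')).1⟩
      exact absurd (hn.card_le m hmn hmm) (not_le.2 (((Set.encard_le_encard hsub).trans
        (Set.encard_image_le _ _)).trans_lt (hfin.encard_lt_encard hss)))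
    obtain ⟨y, hy, hfresh⟩ := hy
    refine ⟨Nat.pair y 0, fun _ => Or.inr ⟨hN, ?_, fun k hk hkk => ?_, Or.inl ⟨m, hmn, hm'⟩⟩⟩
    · simpa using h.right.left hy
    · simp only [Nat.unpair_pair]
      refine ⟨?_, hfresh k hk hkk⟩
      rw [← h.left.congr_right hm', (hn.embedsOn k m hk hmn hkk hmm).1]
      exact h.right.congr_right (h.right.symm hy)
  · obtain ⟨v, h1, h2, h3⟩ := h.exists_new n hN hnn (by push Not at hm; exact hm)
      ((Finset.range n).image f)
    have h2' : ∀ k < n, ¬ S (f k) v.unpair.1 := fun k hk =>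
      h2 _ (Finset.mem_image_of_mem f (Finset.mem_range.2 hk))
    refine ⟨v, fun _ => Or.inr ⟨hN, h1, fun k hk hkk => ⟨?_, fun heq => ?_⟩, Or.inr h3⟩⟩
    · exact iff_of_false (fun h' => hm ⟨k, hk, h'⟩) (h2' k hk)
    · exact h2' k hk (heq ▸ h1)

theorem invariant (h : GreedyEmbeddable R S e N Q) (n : ℕ) :
    Invariant R S e N n (map R S e N Q) := by
  induction n with
  | zero => exact ⟨fun m n hm => absurd hm (by simp), fun m hm => absurd hm (by simp),
      fun m hm => absurd hm (by simp)⟩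
  | succ n ih =>
    -- The invariant up to `n` makes the set of admissible values nonempty, so its infimum is
    -- admissible.
    have hstep := step_iff.1 (Nat.sInf_mem (h.exists_step ih))
    change R n n → (n < N ∧ map R S e N Q n = e n) ∨ (N ≤ n ∧
      S (map R S e N Q n) (map R S e N Q n) ∧ (∀ m < n, R m m → (R m n ↔
        S (map R S e N Q m) (map R S e N Q n)) ∧ map R S e N Q m ≠ map R S e N Q n) ∧
      ((∃ m < n, R m n) ∨ Q (n, greedy (EmbeddingStep R S e N Q) n))) at hstep
    have hQ := h.card_le_of n (greedy (EmbeddingStep R S e N Q) n)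
    change R n n → _ → _ ≤ classCard S (map R S e N Q n) at hQ
    generalize map R S e N Q = f at *
    have hlast : R n n → S (f n) (f n) ∧ (∀ m < n, R m m → (R m n ↔ S (f m) (f n)) ∧ f m ≠ f n) ∧
        classCard R n ≤ classCard S (f n) ∧ (n < N → f n = e n) := by
      intro hnn
      rcases hstep hnn with ⟨hN, hfn⟩ | ⟨hN, h1, h2, h3⟩
      · rw [hfn]
        refine ⟨(h.embedsOn n n hN hN hnn hnn).1.1 hnn, fun m hm hmm => ?_, h.card_le n hN hnn,
          fun _ => rfl⟩
        rw [ih.eq m hm (hm.trans hN) hmm]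
        exact ⟨(h.embedsOn m n (hm.trans hN) hN hmm hnn).1,
          fun heq => hm.ne ((h.embedsOn m n (hm.trans hN) hN hmm hnn).2 heq)⟩
      · refine ⟨h1, h2, ?_, fun hlt => absurd hlt (not_lt.2 hN)⟩
        rcases h3 with ⟨m, hm, hmn⟩ | h3
        · have hmm := h.left.left hmn
          rw [← h.left.classCard_eq hmn, ← h.right.classCard_eq ((h2 m hm hmm).1.1 hmn)]
          exact ih.card_le m hm hmm
        · exact hQ hnn h3
    refine ⟨fun m k hm hk hmm hkk => ?_, fun m hm hmm => ?_, fun m hm hN hmm => ?_⟩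
    · rcases Nat.lt_succ_iff_lt_or_eq.1 hm with hm | rfl <;>
        rcases Nat.lt_succ_iff_lt_or_eq.1 hk with hk | rfl
      · exact ih.embedsOn m k hm hk hmm hkk
      · obtain ⟨h1, h2⟩ := (hlast hkk).2.1 m hm hmm
        exact ⟨h1, fun heq => absurd heq h2⟩
      · obtain ⟨h1, h2⟩ := (hlast hmm).2.1 k hk hkk
        refine ⟨⟨fun h' => ?_, fun h' => ?_⟩, fun heq => absurd heq.symm h2⟩
        · exact h.right.symm (h1.1 (h.left.symm h'))
        · exact h.left.symm (h1.2 (h.right.symm h'))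
      · exact ⟨iff_of_true hmm (hlast hmm).1, fun _ => rfl⟩
    · rcases Nat.lt_succ_iff_lt_or_eq.1 hm with hm | rfl
      · exact ih.card_le m hm hmm
      · exact (hlast hmm).2.2.1
    · rcases Nat.lt_succ_iff_lt_or_eq.1 hm with hm | rfl
      · exact ih.eq m hm hN hmm
      · exact (hlast hmm).2.2.2 hN

theorem map_embedsOn (h : GreedyEmbeddable R S e N Q) :
    EmbedsOn R S (fun _ => True) (map R S e N Q) := fun m n _ _ =>
  (h.invariant (max m n + 1)).embedsOn m n (Nat.lt_succ_of_le (le_max_left _ _))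
    (Nat.lt_succ_of_le (le_max_right _ _))

theorem map_recursiveIn (h : GreedyEmbeddable R S e N Q) {n : ℕ}
    (hR : ComputablePred fun p : ℕ × ℕ => R p.1 p.2)
    (hS : ComputablePred fun p : ℕ × ℕ => S p.1 p.2) (he : Computable e) (hQ : ArithPi n Q) :
    Nat.RecursiveIn {charFun (zeroJump n)} fun k => Part.some (map R S e N Q k) := by
  have hfst : Computable fun k : ℕ => k.unpair.1 := Computable.unpair_fst Computable.id
  refine ((Partrec.nat_iff.1 hfst).recursiveIn.comp (greedy_recursiveIn (X := zeroJump n)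
    (ArithPi.le_zeroJump ?_) fun k => h.exists_step (h.invariant k))).of_eq fun k =>
      Part.bind_some _ _
  exact (EmbeddingStep.arithPi hR hS he hQ).comp (f := fun z : ℕ =>
    (Denumerable.ofNat (List ℕ) z.unpair.1, z.unpair.2))
    (((Computable.ofNat _).comp (Computable.unpair_fst Computable.id)).pair
      (Computable.unpair_snd Computable.id))

end GreedyEmbeddable

/-! ### Comparing the sizes of classes -/

theorem encard_lt_eq_countBelow (p : ℕ → Prop) (s : ℕ) :
    {k | k < s ∧ p k}.encard = countBelow p s := by
  classical
  have : {k | k < s ∧ p k} = ((Finset.range s).filter p : Finset ℕ) := by ext; simp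
  rw [this, Set.encard_coe_eq_coe_finsetCard]
  unfold countBelow
  rw [Nat.count_eq_card_filter_range]

theorem natCast_le_encard_iff {p : ℕ → Prop} {k : ℕ} :
    (k : ℕ∞) ≤ {n | p n}.encard ↔ ∃ s, k ≤ countBelow p s := by
  constructor
  · intro h
    obtain ⟨t, ht, hcard⟩ := Set.exists_subset_encard_eq h
    have hfin : t.Finite := Set.finite_of_encard_eq_coe hcard
    obtain ⟨b, hb⟩ := hfin.bddAbove
    refine ⟨b + 1, ?_⟩
    have : t ⊆ {n | n < b + 1 ∧ p n} := fun n hn => ⟨Nat.lt_succ_of_le (hb hn), ht hn⟩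
    have := Set.encard_le_encard this
    rw [encard_lt_eq_countBelow, hcard] at this
    exact_mod_cast this
  · rintro ⟨s, hs⟩
    refine le_trans (Nat.cast_le.2 hs) ?_
    rw [← encard_lt_eq_countBelow]
    exact Set.encard_le_encard fun n hn => hn.2

theorem countBelow_le_encard (p : ℕ → Prop) (s : ℕ) : (countBelow p s : ℕ∞) ≤ {n | p n}.encard :=
  natCast_le_encard_iff.2 ⟨s, le_rfl⟩

/-- Sizes are compared through their finite lower bounds. For computable classes this exhibits the
comparison as a `Π⁰₂` condition, including the infinite case. -/
theorem encard_le_encard_iff {p q : ℕ → Prop} :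
    {n | p n}.encard ≤ {n | q n}.encard ↔ ∀ s, ∃ t, countBelow p s ≤ countBelow q t := by
  constructor
  · exact fun h s => natCast_le_encard_iff.1 ((countBelow_le_encard p s).trans h)
  · intro h
    refine ENat.forall_natCast_le_iff_le.1 fun k hk => ?_
    obtain ⟨s, hs⟩ := natCast_le_encard_iff.1 hk
    obtain ⟨t, ht⟩ := h s
    exact natCast_le_encard_iff.2 ⟨t, hs.trans ht⟩

theorem countBelow_class_computable {α : Type} [Primcodable α] {R : ℕ → ℕ → Prop}
    (hR : ComputablePred fun p : ℕ × ℕ => R p.1 p.2) {n s : α → ℕ} (hn : Computable n)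
    (hs : Computable s) : Computable fun a => countBelow (fun k => R k (n a)) (s a) :=
  countBelow_computable (p := fun z : α × ℕ => R z.2 (n z.1))
    (hR.comp (Computable.snd.pair (hn.comp Computable.fst))) hs

/-! ### Embeddings of computable equivalence structures -/

namespace EquivStructure

/-- The relation of an equivalence structure as a relation on the natural numbers. -/
def rel (A : EquivStructure) (x y : ℕ) : Prop :=
  ∃ (hx : x ∈ A.carrier) (hy : y ∈ A.carrier), A.eqv.r ⟨x, hx⟩ ⟨y, hy⟩

theorem rel_coe {A : EquivStructure} {x y : A.carrier} : A.rel x y ↔ A.eqv.r x y :=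
  ⟨fun ⟨_, _, h⟩ => h, fun h => ⟨x.2, y.2, h⟩⟩

theorem rel_self {A : EquivStructure} {x : ℕ} : A.rel x x ↔ x ∈ A.carrier :=
  ⟨fun ⟨h, _, _⟩ => h, fun h => ⟨h, h, A.eqv.iseqv.refl _⟩⟩

theorem isPER_rel (A : EquivStructure) : IsPER A.rel where
  symm := fun ⟨hx, hy, h⟩ => ⟨hy, hx, A.eqv.iseqv.symm h⟩
  trans := fun ⟨hx, _, h⟩ ⟨_, hz, h'⟩ => ⟨hx, hz, A.eqv.iseqv.trans h h'⟩

/-- An embedding as a total function on the natural numbers. -/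
noncomputable def Embedding.toFun {A B : EquivStructure} (f : Embedding A B) (n : ℕ) : ℕ :=
  open Classical in if h : n ∈ A.carrier then f ⟨n, h⟩ else 0

theorem Embedding.toFun_coe {A B : EquivStructure} (f : Embedding A B) (x : A.carrier) :
    f.toFun x = f x := by
  simp [Embedding.toFun]

theorem Embedding.embedsOn {A B : EquivStructure} (f : Embedding A B) :
    EmbedsOn A.rel B.rel (fun _ => True) f.toFun := by
  intro m n _ _ hm hn
  lift m to A.carrier using rel_self.1 hm
  lift n to A.carrier using rel_self.1 hn
  rw [f.toFun_coe, f.toFun_coe, rel_coe, rel_coe]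
  exact ⟨f.map_rel_iff.symm, fun h => congrArg _ (f.injective (Subtype.ext h))⟩

/-- The embedding given by a function on the natural numbers. -/
def embeddingOfEmbedsOn {A B : EquivStructure} {f : ℕ → ℕ}
    (hf : EmbedsOn A.rel B.rel (fun _ => True) f) : Embedding A B where
  toFun x := ⟨f x, rel_self.1 ((hf x x trivial trivial (rel_self.2 x.2) (rel_self.2 x.2)).1.1
    (rel_self.2 x.2))⟩
  inj' x y hxy := Subtype.ext ((hf x y trivial trivial (rel_self.2 x.2) (rel_self.2 y.2)).2
    (congrArg Subtype.val hxy))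
  map_rel_iff' {x y} := by
    rw [← rel_coe, ← rel_coe]
    exact (hf x y trivial trivial (rel_self.2 x.2) (rel_self.2 y.2)).1.symm

theorem toPFun_embeddingOfEmbedsOn_le {A B : EquivStructure} {f : ℕ → ℕ}
    (hf : EmbedsOn A.rel B.rel (fun _ => True) f) (hA : A.IsComputable) {X : Set ℕ}
    (hX : Nat.RecursiveIn {charFun X} fun n => Part.some (f n)) :
    Embedding.toPFun (embeddingOfEmbedsOn hf) ≤ᵀ charFun X := by
  classical
  -- Composing with the identity restricted to the universe gives the partial function the right
  -- domain.
  have hdom : Nat.Partrec fun n => if n ∈ A.carrier then Part.some n else Part.none := by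
    refine Partrec.nat_iff.1 ((Partrec.cond hA.1.decide Partrec.some Partrec.none).of_eq
      fun n => ?_)
    by_cases hn : n ∈ A.carrier <;> simp [hn]
  refine RecursiveIn.iff_nat.2 ((hX.comp hdom.recursiveIn).of_eq fun n => ?_)
  by_cases hn : n ∈ A.carrier
  · simp only [hn, if_true]
    exact (Part.bind_some _ _).trans (Part.eq_some_iff.2
      (show f n ∈ Embedding.toPFun (embeddingOfEmbedsOn hf) n from ⟨hn, rfl⟩)).symm
  · simp only [hn, if_false]
    exact (Part.bind_none _).trans (Part.eq_none_iff'.2 hn).symm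

theorem exists_embedding_of_greedy {A B : EquivStructure} (hA : A.IsComputable)
    (hB : B.IsComputable) {e : ℕ → ℕ} {N n : ℕ} {Q : ℕ × ℕ → Prop} (he : Computable e)
    (hQ : ArithPi n Q) (h : GreedyEmbeddable A.rel B.rel e N Q) :
    ∃ f : Embedding A B, Embedding.toPFun f ≤ᵀ charFun (zeroJump n) :=
  ⟨_, toPFun_embeddingOfEmbedsOn_le h.map_embedsOn hA (h.map_recursiveIn hA.2 hB.2 he hQ)⟩

/-- A finite table is computable, so finitely many values of a noncomputable embedding may be built
into the construction. -/
theorem computable_truncate (e : ℕ → ℕ) (N : ℕ) :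
    ∃ e' : ℕ → ℕ, Computable e' ∧ ∀ n < N, e' n = e n := by
  refine ⟨fun n => ((List.range N).map e).getD n 0,
    (Primrec.list_getD 0).to_comp.comp (Computable.const _) Computable.id, fun n hn => ?_⟩
  simp [List.getD_eq_getElem?_getD, hn]

/-- The finite information about an embedding that the greedy construction uses. -/
theorem exists_bound_of_embedding {A B : EquivStructure} (f : Embedding A B) :
    ∃ (e : ℕ → ℕ) (N : ℕ), Computable e ∧ EmbedsOn A.rel B.rel (· < N) e ∧
      (∀ n < N, A.rel n n → classCard A.rel n ≤ classCard B.rel (e n)) ∧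
      ∀ n, A.rel n n → (∀ m < N, ¬ A.rel m n) → ManyClasses B.rel (classCard A.rel n) := by
  obtain ⟨N, hN⟩ := f.embedsOn.exists_bound A.isPER_rel B.isPER_rel
  obtain ⟨e, he, heq⟩ := computable_truncate f.toFun N
  refine ⟨e, N, he, fun m n hm hn => ?_, fun n hn hnn => ?_, hN⟩
  · rw [heq m hm, heq n hn]
    exact f.embedsOn m n trivial trivial
  · rw [heq n hn]
    exact f.embedsOn.classCard_le A.isPER_rel hnn

/-- Between embeddable computable equivalence structures there is an embedding that is computable
in the second jump. -/
theorem exists_embedding_le_zeroJump_two {A B : EquivStructure} (hA : A.IsComputable)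
    (hB : B.IsComputable) (h : Nonempty (Embedding A B)) :
    ∃ f : Embedding A B, Embedding.toPFun f ≤ᵀ charFun (zeroJump 2) := by
  obtain ⟨f⟩ := h
  obtain ⟨e, N, he, hemb, hcard, hN⟩ := exists_bound_of_embedding f
  have hQ : ArithPi 2 fun z : ℕ × ℕ => ∀ s, ∃ t, countBelow (fun k => A.rel k z.1) s ≤
      countBelow (fun k => B.rel k z.2.unpair.1) t := by
    refine ArithPi.forall_nat (p := fun y : (ℕ × ℕ) × ℕ => ∃ t,
      countBelow (fun k => A.rel k y.1.1) y.2 ≤ countBelow (fun k => B.rel k y.1.2.unpair.1) t) ?_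
    refine ArithSigma.pi_succ (ArithSigma.exists_nat (p := fun y : ((ℕ × ℕ) × ℕ) × ℕ =>
      countBelow (fun k => A.rel k y.1.1.1) y.1.2 ≤
        countBelow (fun k => B.rel k y.1.1.2.unpair.1) y.2) ?_)
    refine (Computable.le_pred (countBelow_class_computable hA.2 ?_ ?_)
      (countBelow_class_computable hB.2 ?_ Computable.snd)).arithSigma
    · exact Computable.fst.comp (Computable.fst.comp Computable.fst)
    · exact Computable.snd.comp Computable.fst
    · exact Computable.unpair_fst (Computable.snd.comp (Computable.fst.comp Computable.fst))
  refine exists_embedding_of_greedy hA hB he hQ (N := N)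
    ⟨A.isPER_rel, B.isPER_rel, hemb, hcard, fun n hn hnn hnew F => ?_,
      fun n v _ h => encard_le_encard_iff.2 h⟩
  obtain ⟨y, h1, h2, h3⟩ := hN n hnn (fun m hm => hnew m (hm.trans_le hn)) F
  exact ⟨Nat.pair y 0, by simpa using ⟨h1, h2, encard_le_encard_iff.1 h3⟩⟩

/-- If the embedding is into a structure with finitely many infinite classes, then the first jump
suffices. -/
theorem exists_embedding_le_zeroJump_one {A B : EquivStructure} (hA : A.IsComputable)
    (hB : B.IsComputable) (h : Nonempty (Embedding A B))
    (hfin : ¬ ManyClasses B.rel ⊤) :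
    ∃ f : Embedding A B, Embedding.toPFun f ≤ᵀ charFun (zeroJump 1) := by
  obtain ⟨f⟩ := h
  obtain ⟨e, N, he, hemb, hcard, hN⟩ := exists_bound_of_embedding f
  -- Besides the image, the chosen value carries a bound `s` for the class of the source element and
  -- a stage `t` by which the target class shows at least as many elements. Only the correctness of
  -- `s` is not computable, and it is `Π⁰₁`.
  let Q : ℕ × ℕ → Prop := fun z => (∀ k, z.2.unpair.2.unpair.1 ≤ k → ¬ A.rel k z.1) ∧
    countBelow (fun k => A.rel k z.1) z.2.unpair.2.unpair.1 ≤
      countBelow (fun k => B.rel k z.2.unpair.1) z.2.unpair.2.unpair.2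
  have hs : Computable fun z : ℕ × ℕ => z.2.unpair.2.unpair.1 :=
    Computable.unpair_fst (Computable.unpair_snd Computable.snd)
  have hQ : ArithPi 1 Q := by
    refine ArithPi.and ?_ (Computable.le_pred (countBelow_class_computable hA.2 Computable.fst hs)
      (countBelow_class_computable hB.2 (Computable.unpair_fst Computable.snd)
        (Computable.unpair_snd (Computable.unpair_snd Computable.snd)))).arithPi
    refine ArithPi.forall_nat (p := fun y : (ℕ × ℕ) × ℕ => y.1.2.unpair.2.unpair.1 ≤ y.2 →
      ¬ A.rel y.2 y.1.1) ?_
    exact ((Computable.le_pred (hs.comp Computable.fst) Computable.snd).imp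
      (hA.2.comp (Computable.snd.pair (Computable.fst.comp Computable.fst))).not).arithPi
  refine exists_embedding_of_greedy hA hB he hQ (N := N)
    ⟨A.isPER_rel, B.isPER_rel, hemb, hcard, fun n hn hnn hnew F => ?_, fun n v _ h => ?_⟩
  · have hmany := hN n hnn fun m hm => hnew m (hm.trans_le hn)
    -- An infinite class here would force infinitely many infinite classes in `B`.
    have hlt : classCard A.rel n ≠ ⊤ := fun h => hfin (h ▸ hmany)
    obtain ⟨b, hb⟩ := (Set.encard_ne_top_iff.1 hlt).bddAbove
    obtain ⟨y, h1, h2, h3⟩ := hmany F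
    obtain ⟨t, ht⟩ := encard_le_encard_iff.1 h3 (b + 1)
    refine ⟨Nat.pair y (Nat.pair (b + 1) t), ?_⟩
    simp only [Nat.unpair_pair, Q]
    exact ⟨h1, h2, fun k hk hkn => absurd (hb hkn) (by omega), ht⟩
  · refine le_trans (le_of_eq ?_) (le_trans (Nat.cast_le.2 h.2) (countBelow_le_encard _ _))
    rw [← encard_lt_eq_countBelow]
    unfold classCard
    congr 1
    ext k
    exact ⟨fun hk => ⟨not_le.1 fun hle => h.1 k hle hk, hk⟩, fun hk => hk.2⟩

/-- Every equivalence structure embeds in one that has infinitely many infinite classes. -/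
theorem nonempty_embedding_of_manyClasses {A B : EquivStructure} (hB : ManyClasses B.rel ⊤) :
    Nonempty (Embedding A B) := by
  have h : GreedyEmbeddable A.rel B.rel id 0 fun z => classCard B.rel z.2.unpair.1 = ⊤ := by
    refine ⟨A.isPER_rel, B.isPER_rel, fun m n hm => absurd hm (by simp),
      fun n hn => absurd hn (by simp), fun n _ _ _ F => ?_, fun n v _ hv => ?_⟩
    · obtain ⟨y, h1, h2, h3⟩ := hB F
      exact ⟨Nat.pair y 0, by simpa using ⟨h1, h2, top_le_iff.1 h3⟩⟩
    · exact (le_of_le_of_eq le_top hv.symm : classCard A.rel n ≤ _)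
  exact ⟨embeddingOfEmbedsOn h.map_embedsOn⟩

/-- Embeddings send distinct classes into distinct classes and infinite ones into infinite ones.
This lets the `0'` bound pass from `A` to all its bi-embeddable copies. -/
theorem Embedding.manyClasses {A B : EquivStructure} (f : Embedding A B)
    (hA : ManyClasses A.rel ⊤) : ManyClasses B.rel ⊤ := by
  classical
  intro F
  have hf := f.embedsOn
  have hg : ∀ s, ∃ x, ∀ z, A.rel z z → B.rel s (f.toFun z) → A.rel x x ∧ B.rel s (f.toFun x) := by
    intro s
    by_cases h : ∃ z, A.rel z z ∧ B.rel s (f.toFun z)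
    · obtain ⟨z, hz⟩ := h
      exact ⟨z, fun _ _ _ => hz⟩
    · exact ⟨0, fun z h1 h2 => absurd ⟨z, h1, h2⟩ h⟩
  choose g hg using hg
  obtain ⟨x, hxx, hx, htop⟩ := hA (F.image g)
  refine ⟨f.toFun x, (hf x x trivial trivial hxx hxx).1.1 hxx, fun s hs hsx => ?_,
    htop.trans (hf.classCard_le A.isPER_rel hxx)⟩
  obtain ⟨h1, h2⟩ := hg s x hxx hsx
  exact hx (g s) (Finset.mem_image_of_mem g hs)
    ((hf _ _ trivial trivial h1 hxx).1.2 (B.isPER_rel.trans (B.isPER_rel.symm h2) hsx))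

theorem hasInfinitelyManyInfiniteClasses_iff {A : EquivStructure} :
    A.HasInfinitelyManyInfiniteClasses ↔ ManyClasses A.rel ⊤ := by
  classical
  have himage : ∀ x : A.carrier, {k | A.rel k x} = Subtype.val '' {y | A.eqv.r y x} := by
    intro x
    ext k
    constructor
    · rintro ⟨hk, hx, h⟩
      exact ⟨⟨k, hk⟩, h, rfl⟩
    · rintro ⟨y, hy, rfl⟩
      exact rel_coe.2 hy
  have hinf : ∀ x : A.carrier, ⊤ ≤ classCard A.rel x ↔ {y | A.eqv.r y x}.Infinite := by
    intro x
    unfold classCard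
    rw [top_le_iff, Set.encard_eq_top_iff, himage,
      Set.infinite_image_iff Subtype.val_injective.injOn]
  constructor
  · intro h F
    let T : Set (Set A.carrier) := ⋃ s ∈ F, {c | ∃ y : A.carrier, (y : ℕ) = s ∧
      c = {z | A.eqv.r z y}}
    have hT : T.Finite := by
      refine Set.Finite.biUnion F.finite_toSet fun s _ => Set.Subsingleton.finite ?_
      rintro _ ⟨y, hy, rfl⟩ _ ⟨z, hz, rfl⟩
      rw [Subtype.ext (hy.trans hz.symm)]
    obtain ⟨c, ⟨⟨x, rfl⟩, hc⟩, hcT⟩ := (h.sdiff hT).nonempty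
    refine ⟨x, rel_self.2 x.2, fun s hs hsx => hcT ?_, (hinf x).2 hc⟩
    obtain ⟨hs', hx, hr⟩ := hsx
    refine Set.mem_biUnion hs ⟨⟨s, hs'⟩, rfl, ?_⟩
    ext z
    exact ⟨fun hz => A.eqv.iseqv.trans hz (A.eqv.iseqv.symm hr),
      fun hz => A.eqv.iseqv.trans hz hr⟩
  · intro h hfin
    have hrep : ∀ c : Set A.carrier, ∃ x : ℕ, c ∈ A.eqv.classes →
        ∃ y : A.carrier, (y : ℕ) = x ∧ c = {z | A.eqv.r z y} := by
      intro c
      by_cases hc : c ∈ A.eqv.classes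
      · obtain ⟨y, rfl⟩ := hc
        exact ⟨y, fun _ => ⟨y, rfl, rfl⟩⟩
      · exact ⟨0, fun h => absurd h hc⟩
    choose g hg using hrep
    obtain ⟨x, hxx, hx, htop⟩ := h (hfin.toFinset.image g)
    lift x to A.carrier using rel_self.1 hxx
    have hmem : {z | A.eqv.r z x} ∈ {c : Set A.carrier | c ∈ A.eqv.classes ∧ c.Infinite} :=
      ⟨⟨x, rfl⟩, (hinf x).1 htop⟩
    refine hx (g {z | A.eqv.r z x}) (Finset.mem_image_of_mem g (hfin.mem_toFinset.2 hmem)) ?_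
    obtain ⟨y, hy, heq⟩ := hg _ hmem.1
    rw [← hy, rel_coe]
    have : x ∈ {z | A.eqv.r z x} := A.eqv.iseqv.refl x
    rw [heq] at this
    exact A.eqv.iseqv.symm this

end EquivStructure

/-! ### Normal forms of `Π⁰₂` predicates -/

/-- A `Π⁰₂` predicate says that a computable event happens infinitely often. -/
theorem ArithPi.exists_infinite {α : Type} [Primcodable α] {p : α → Prop} (hp : ArithPi 2 p) :
    ∃ D : α × ℕ → Prop, ComputablePred D ∧ ∀ a, p a ↔ {t | D (a, t)}.Infinite := by
  classical
  obtain ⟨q, ⟨r, hr, hqr⟩, hpq⟩ := hp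
  replace hr : ComputablePred r := hr
  have hpr : ∀ a, p a ↔ ∀ x, ∃ y, ¬ r ((a, x), y) := fun a => by
    simp only [← hqr]
    simpa using not_congr (hpq a)
  -- `M ((a, n), s)`: all `x < n` have witnesses below `s`. The event `D` occurs at `⟨n, s⟩` if `s`
  -- is the least such stage, so at most once for each `n`; if some `x` has no witness, it occurs
  -- only for `n ≤ x`.
  let M : (α × ℕ) × ℕ → Prop := fun z => ∀ x < z.1.2, ∃ y < z.2, ¬ r ((z.1.1, x), y)
  have hM : ComputablePred M := by
    refine ComputablePred.forall_lt (p := fun w : ((α × ℕ) × ℕ) × ℕ =>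
      ∃ y < w.1.2, ¬ r ((w.1.1.1, w.2), y)) ?_ (Computable.snd.comp Computable.fst)
    refine ComputablePred.exists_lt (p := fun w : (((α × ℕ) × ℕ) × ℕ) × ℕ =>
      ¬ r ((w.1.1.1.1, w.1.2), w.2)) ?_ (Computable.snd.comp Computable.fst)
    refine (hr.comp (Computable.pair (Computable.pair ?_ (Computable.snd.comp Computable.fst))
      Computable.snd)).not
    exact Computable.fst.comp (Computable.fst.comp (Computable.fst.comp Computable.fst))
  have h1 : Computable fun z : α × ℕ => z.2.unpair.1 := Computable.unpair_fst Computable.snd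
  have h2 : Computable fun z : α × ℕ => z.2.unpair.2 := Computable.unpair_snd Computable.snd
  refine ⟨fun z => M ((z.1, z.2.unpair.1), z.2.unpair.2) ∧
    ∀ s < z.2.unpair.2, ¬ M ((z.1, z.2.unpair.1), s),
    (hM.comp ((Computable.fst.pair h1).pair h2)).and
      (ComputablePred.forall_lt (p := fun w : (α × ℕ) × ℕ => ¬ M ((w.1.1, w.1.2.unpair.1), w.2))
        (hM.comp (((Computable.fst.comp Computable.fst).pair (h1.comp Computable.fst)).pair
          Computable.snd)).not h2), fun a => ?_⟩
  rw [hpr]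
  constructor
  · intro h
    have hex : ∀ n, ∃ s, M ((a, n), s) := by
      intro n
      choose y hy using h
      exact ⟨(Finset.range n).sup y + 1, fun x hx => ⟨y x,
        Nat.lt_succ_of_le (Finset.le_sup (Finset.mem_range.2 hx)), hy x⟩⟩
    refine (Set.infinite_range_of_injective (f := fun n => Nat.pair n (Nat.find (hex n)))
      fun m n hmn => (Nat.pair_eq_pair.1 hmn).1).mono ?_
    rintro _ ⟨n, rfl⟩
    simp only [Set.mem_ofPred_eq, Nat.unpair_pair]
    exact ⟨Nat.find_spec (hex n), fun s hs => Nat.find_min (hex n) hs⟩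
  · intro h x
    by_contra hx
    refine h (Set.Finite.of_finite_image (f := fun t : ℕ => t.unpair.1)
      ((Set.finite_le_nat x).subset ?_) ?_)
    · rintro _ ⟨t, ht, rfl⟩
      change t.unpair.1 ≤ x
      refine not_lt.1 fun hlt => hx ?_
      obtain ⟨y, -, hy⟩ := ht.1 x hlt
      exact ⟨y, hy⟩
    · intro t ht t' ht' heq
      have heq : t.unpair.1 = t'.unpair.1 := heq
      have h3 : t.unpair.2 = t'.unpair.2 := by
        have ha := ht.1
        have hb := ht'.1
        have ha' := ht.2
        have hb' := ht'.2
        simp only [heq] at ha ha'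
        exact le_antisymm (not_lt.1 fun hlt => ha' _ hlt hb) (not_lt.1 fun hlt => hb' _ hlt ha)
      rw [← Nat.pair_unpair t, ← Nat.pair_unpair t', heq, h3]

/-- Witnesses of a `Σ⁰₃` predicate can be taken to be unique. -/
theorem ArithPi.exists_unique_witness {α : Type} [Primcodable α] {p : α × ℕ → Prop}
    (hp : ArithPi 2 p) : ∃ p' : α × ℕ → Prop, ArithPi 2 p' ∧
      (∀ a v, p' (a, v) → p (a, v.unpair.1)) ∧ (∀ a, (∃ v, p (a, v)) → ∃ v, p' (a, v)) ∧
      ∀ a v w, p' (a, v) → p' (a, w) → v = w := by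
  classical
  obtain ⟨D, hD, hpD⟩ := hp.exists_infinite
  -- For each `v'`, the event happens infinitely often iff `p (a, v')`. Hence some stage is quiet
  -- for `v` iff no smaller number is a witness, and the new witness is the pair of the least
  -- witness and its least quiet stage. Minimality of the stage `s` says that `s = 0` or an event
  -- occurs at `s - 1`, which is computable, so `p'` remains `Π⁰₂`.
  let quiet : α → ℕ → ℕ → Prop := fun a v s => ∀ v' t, v' < v → s ≤ t → ¬ D ((a, v'), t)
  refine ⟨fun z => p (z.1, z.2.unpair.1) ∧ quiet z.1 z.2.unpair.1 z.2.unpair.2 ∧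
    (z.2.unpair.2 = 0 ∨ ∃ v' < z.2.unpair.1, D ((z.1, v'), z.2.unpair.2 - 1)), ?_,
    fun a v h => h.1, ?_, ?_⟩
  · have h1 : Computable fun z : α × ℕ => z.2.unpair.1 := Computable.unpair_fst Computable.snd
    have h2 : Computable fun z : α × ℕ => z.2.unpair.2 := Computable.unpair_snd Computable.snd
    refine ArithPi.and (hp.comp (Computable.fst.pair h1)) (ArithPi.and ?_ ?_)
    · refine ArithPi.forall_nat (p := fun y : (α × ℕ) × ℕ => ∀ t, y.2 < y.1.2.unpair.1 →
        y.1.2.unpair.2 ≤ t → ¬ D ((y.1.1, y.2), t)) ?_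
      refine ArithPi.forall_nat (p := fun y : ((α × ℕ) × ℕ) × ℕ => y.1.2 < y.1.1.2.unpair.1 →
        y.1.1.2.unpair.2 ≤ y.2 → ¬ D ((y.1.1.1, y.1.2), y.2)) (ComputablePred.arithPi ?_)
      have h11 : Computable fun y : ((α × ℕ) × ℕ) × ℕ => y.1.1 := Computable.fst.comp Computable.fst
      have h12 : Computable fun y : ((α × ℕ) × ℕ) × ℕ => y.1.2 := Computable.snd.comp Computable.fst
      exact (Computable.lt_pred h12 (h1.comp h11)).imp
        ((Computable.le_pred (h2.comp h11) Computable.snd).imp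
          (hD.comp (((Computable.fst.comp h11).pair h12).pair Computable.snd)).not)
    · refine ((Computable.eq_pred h2 (Computable.const 0)).or ?_).arithPi
      refine ComputablePred.exists_lt (p := fun y : (α × ℕ) × ℕ =>
        D ((y.1.1, y.2), y.1.2.unpair.2 - 1)) (hD.comp
          (((Computable.fst.comp Computable.fst).pair Computable.snd).pair ?_)) h1
      exact Computable.pred.comp (h2.comp Computable.fst)
  · intro a hex
    have hspec := Nat.find_spec hex
    have hmin : ∀ v' < Nat.find hex, {t | D ((a, v'), t)}.Finite := fun v' hv' =>
      Set.not_infinite.1 fun h => Nat.find_min hex hv' ((hpD _).2 h)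
    generalize Nat.find hex = v at *
    have hs : ∃ s, quiet a v s := by
      have hfin : (⋃ v' ∈ Set.Iio v, {t | D ((a, v'), t)}).Finite :=
        (Set.finite_Iio v).biUnion hmin
      obtain ⟨b, hb⟩ := hfin.bddAbove
      refine ⟨b + 1, fun v' t hv' ht hDt => ?_⟩
      have := hb (Set.mem_biUnion (Set.mem_Iio.2 hv') hDt)
      omega
    refine ⟨Nat.pair v (Nat.find hs), ?_⟩
    simp only [Nat.unpair_pair]
    refine ⟨hspec, Nat.find_spec hs, or_iff_not_imp_left.2 fun h0 => ?_⟩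
    -- The stage before the least quiet one is not quiet, and the offending event can only occur at
    -- that very stage.
    have := Nat.find_min hs (Nat.pred_lt h0)
    simp only [quiet] at this
    push Not at this
    obtain ⟨v', t, hv', ht, hDt⟩ := this
    have htlt : t < Nat.find hs := not_le.1 fun hle => Nat.find_spec hs v' t hv' hle hDt
    have ht' : Nat.find hs - 1 ≤ t := ht
    rw [show t = Nat.find hs - 1 by omega] at hDt
    exact ⟨v', hv', hDt⟩
  · have hle : ∀ a v w, p (a, v) → ∀ s, quiet a w s → w ≤ v := by
      intro a v w hv s hq
      by_contra hlt
      obtain ⟨t, ht, hst⟩ := ((hpD _).1 hv).exists_gt s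
      exact hq v t (not_le.1 hlt) hst.le ht
    have hle' : ∀ a v s s', quiet a v s → (s' = 0 ∨ ∃ v' < v, D ((a, v'), s' - 1)) → s' ≤ s := by
      intro a v s s' hq h
      by_contra hlt
      rcases h with rfl | ⟨v', hv', hDs⟩
      · exact hlt (Nat.zero_le _)
      · exact hq v' _ hv' (by omega) hDs
    rintro a v w ⟨h1, h2, h3⟩ ⟨h1', h2', h3'⟩
    have heq := le_antisymm (hle _ _ _ h1' _ h2) (hle _ _ _ h1 _ h2')
    simp only at heq h2 h2' h3 h3'
    rw [heq] at h2 h3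
    rw [← Nat.pair_unpair v, ← Nat.pair_unpair w, heq,
      le_antisymm (hle' _ _ _ _ h2' h3) (hle' _ _ _ _ h2 h3')]

/-- The lists of witnesses of the initial segments of a `Π⁰₄` statement, made unique and
presented by a computable event that happens infinitely often. -/
theorem ArithPi.exists_witness_lists {p : (ℕ × ℕ) × ℕ → Prop} (hp : ArithPi 2 p) :
    ∃ G : ℕ × ℕ → Prop, ComputablePred G ∧ ∀ b,
      (∀ c, {t | G (b, Nat.pair c t)}.Infinite →
        ∀ i v, (Denumerable.ofNat (List ℕ) c)[i]? = some v → p ((b, i), v.unpair.1)) ∧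
      (∀ c c', {t | G (b, Nat.pair c t)}.Infinite → {t | G (b, Nat.pair c' t)}.Infinite →
        (Denumerable.ofNat (List ℕ) c).length = (Denumerable.ofNat (List ℕ) c').length →
          c = c') ∧
      ∀ n, (∀ i < n, ∃ v, p ((b, i), v)) → ∃ c, {t | G (b, Nat.pair c t)}.Infinite ∧
        (Denumerable.ofNat (List ℕ) c).length = n := by
  obtain ⟨p', hp', hsound, hcomplete, hunique⟩ := hp.exists_unique_witness
  -- The number `z.2` codes a list whose entries are the unique witnesses for an initial segment.
  -- Uniqueness makes such a list determined by its length.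
  let correct : ℕ × ℕ → Prop := fun z => ∀ i v,
    ¬ ((Denumerable.ofNat (List ℕ) z.2)[i]? = some v) ∨ p' ((z.1, i), v)
  have hcorrect : ArithPi 2 correct := by
    refine ArithPi.forall_nat (p := fun y : (ℕ × ℕ) × ℕ => ∀ v,
      ¬ ((Denumerable.ofNat (List ℕ) y.1.2)[y.2]? = some v) ∨ p' ((y.1.1, y.2), v)) ?_
    refine ArithPi.forall_nat (p := fun y : ((ℕ × ℕ) × ℕ) × ℕ =>
      ¬ ((Denumerable.ofNat (List ℕ) y.1.1.2)[y.1.2]? = some y.2) ∨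
        p' ((y.1.1.1, y.1.2), y.2)) ?_
    have h11 : Computable fun y : ((ℕ × ℕ) × ℕ) × ℕ => y.1.1 := Computable.fst.comp Computable.fst
    have h12 : Computable fun y : ((ℕ × ℕ) × ℕ) × ℕ => y.1.2 := Computable.snd.comp Computable.fst
    refine ArithPi.or (ComputablePred.arithPi ?_) (hp'.comp
      (((Computable.fst.comp h11).pair h12).pair Computable.snd))
    exact (Computable.eq_pred (Computable.list_getElem?.comp ((Computable.ofNat _).comp
      (Computable.snd.comp h11)) h12) (Computable.option_some.comp Computable.snd)).not
  obtain ⟨G, hG, hcG⟩ := hcorrect.exists_infinite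
  have hcG' : ∀ b c, {t | G ((b, (Nat.pair c t).unpair.1), (Nat.pair c t).unpair.2)}.Infinite ↔
      ∀ i v, (Denumerable.ofNat (List ℕ) c)[i]? = some v → p' ((b, i), v) := fun b c => by
    simp only [Nat.unpair_pair, ← hcG, correct, imp_iff_not_or]
  refine ⟨fun z => G ((z.1, z.2.unpair.1), z.2.unpair.2), hG.comp
    ((Computable.fst.pair (Computable.unpair_fst Computable.snd)).pair
      (Computable.unpair_snd Computable.snd)), fun b => ⟨?_, ?_, ?_⟩⟩
  · exact fun c hc i v hv => hsound _ _ ((hcG' b c).1 hc i v hv)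
  · intro c c' hc hc' hlen
    rw [← Denumerable.encode_ofNat (α := List ℕ) c, ← Denumerable.encode_ofNat (α := List ℕ) c']
    congr 1
    refine List.ext_getElem hlen fun i h1 h2 => ?_
    exact hunique _ _ _ ((hcG' b c).1 hc i _ (List.getElem?_eq_getElem h1))
      ((hcG' b c').1 hc' i _ (List.getElem?_eq_getElem h2))
  · intro n hn
    have : ∀ i, ∃ v, i < n → p' ((b, i), v) := by
      intro i
      by_cases hi : i < n
      · obtain ⟨v, hv⟩ := hcomplete (b, i) (hn i hi)
        exact ⟨v, fun _ => hv⟩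
      · exact ⟨0, fun h => absurd h hi⟩
    choose g hg using this
    refine ⟨Encodable.encode ((List.range n).map g), (hcG' b _).2 ?_, by simp⟩
    intro i v hv
    rw [Denumerable.ofNat_encode, List.getElem?_map, Option.map_eq_some_iff] at hv
    obtain ⟨j, hj, rfl⟩ := hv
    obtain ⟨hlt, rfl⟩ := List.getElem?_eq_some_iff.1 hj
    simp only [List.getElem_range]
    exact hg i (by simpa using hlt)

/-! ### Equivalence structures that code families of sets -/

/-- The equivalence relation whose classes are the sets `{⟨c, t⟩ | G ⟨c, t⟩}` for `c ∈ ω`, and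
singletons. -/
def FamilyRel (G : ℕ → Prop) (x y : ℕ) : Prop :=
  x = y ∨ (x.unpair.1 = y.unpair.1 ∧ G x ∧ G y)

theorem familyRel_equivalence (G : ℕ → Prop) : Equivalence (FamilyRel G) := by
  refine ⟨fun x => Or.inl rfl, ?_, ?_⟩
  · rintro x y (h | ⟨h1, h2, h3⟩)
    · exact Or.inl h.symm
    · exact Or.inr ⟨h1.symm, h3, h2⟩
  · rintro x y z (rfl | ⟨h1, h2, h3⟩) (rfl | ⟨h1', h2', h3'⟩)
    · exact Or.inl rfl
    · exact Or.inr ⟨h1', h2', h3'⟩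
    · exact Or.inr ⟨h1, h2, h3⟩
    · exact Or.inr ⟨h1.trans h1', h2, h3'⟩

theorem familyRel_computable {α : Type} [Primcodable α] {G : α × ℕ → Prop}
    (hG : ComputablePred G) :
    ComputablePred fun z : α × (ℕ × ℕ) => FamilyRel (fun n => G (z.1, n)) z.2.1 z.2.2 := by
  have h1 : Computable fun z : α × (ℕ × ℕ) => z.2.1 := Computable.fst.comp Computable.snd
  have h2 : Computable fun z : α × (ℕ × ℕ) => z.2.2 := Computable.snd.comp Computable.snd
  exact (Computable.eq_pred h1 h2).or ((Computable.eq_pred (Computable.unpair_fst h1)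
    (Computable.unpair_fst h2)).and ((hG.comp (Computable.fst.pair h1)).and
      (hG.comp (Computable.fst.pair h2))))

theorem classCard_familyRel_eq_top_iff {G : ℕ → Prop} {y : ℕ} :
    classCard (FamilyRel G) y = ⊤ ↔ G y ∧ {t | G (Nat.pair y.unpair.1 t)}.Infinite := by
  unfold classCard
  rw [Set.encard_eq_top_iff]
  by_cases hy : G y
  · have : {k | FamilyRel G k y} = Nat.pair y.unpair.1 '' {t | G (Nat.pair y.unpair.1 t)} := by
      ext k
      constructor
      · rintro (rfl | ⟨h1, h2, h3⟩)
        · exact ⟨k.unpair.2, by simpa using hy, by simp⟩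
        · refine ⟨k.unpair.2, ?_, ?_⟩ <;> rw [← h1] <;> simp [h2]
      · rintro ⟨t, ht, rfl⟩
        exact Or.inr ⟨by simp, ht, hy⟩
    rw [this, Set.infinite_image_iff fun a _ b _ h => (Nat.pair_eq_pair.1 h).2]
    exact (and_iff_right hy).symm
  · refine iff_of_false (Set.not_infinite.2 ((Set.finite_singleton y).subset ?_)) fun h => hy h.1
    rintro k (rfl | ⟨_, _, h⟩)
    · rfl
    · exact absurd h hy

theorem manyClasses_familyRel_iff {G : ℕ → Prop} :
    ManyClasses (FamilyRel G) ⊤ ↔ {c | {t | G (Nat.pair c t)}.Infinite}.Infinite := by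
  classical
  constructor
  · intro h hfin
    have hrep : ∀ c, ∃ x, {t | G (Nat.pair c t)}.Infinite → x.unpair.1 = c ∧ G x := by
      intro c
      by_cases hc : {t | G (Nat.pair c t)}.Infinite
      · obtain ⟨t, ht⟩ := hc.nonempty
        exact ⟨Nat.pair c t, fun _ => ⟨by simp, ht⟩⟩
      · exact ⟨0, fun h => absurd h hc⟩
    choose g hg using hrep
    obtain ⟨y, -, hy, htop⟩ := h (hfin.toFinset.image g)
    obtain ⟨h1, h2⟩ := classCard_familyRel_eq_top_iff.1 (top_le_iff.1 htop)
    exact hy _ (Finset.mem_image_of_mem g (hfin.mem_toFinset.2 h2))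
      (Or.inr ⟨(hg _ h2).1, (hg _ h2).2, h1⟩)
  · intro h F
    obtain ⟨c, hc, hcF⟩ := h.exists_notMem_finset (F.image fun s => s.unpair.1)
    obtain ⟨t, ht⟩ := Set.Infinite.nonempty hc
    replace ht : G (Nat.pair c t) := ht
    refine ⟨Nat.pair c t, Or.inl rfl, fun s hs hsy => hcF ?_, ?_⟩
    · have : s.unpair.1 = c := by
        rcases hsy with rfl | ⟨h1, -, -⟩
        · simp
        · simpa using h1
      exact this ▸ Finset.mem_image_of_mem _ hs
    · refine (classCard_familyRel_eq_top_iff.2 ⟨ht, ?_⟩).ge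
      simpa using hc

/-- The equivalence structure with universe `ω` and the relation `FamilyRel G`. -/
def familyStructure (G : ℕ → Prop) : EquivStructure where
  carrier := Set.univ
  eqv :=
    { r := fun x y => FamilyRel G x y
      iseqv := ⟨fun x => (familyRel_equivalence G).refl x,
        fun h => (familyRel_equivalence G).symm h,
        fun h h' => (familyRel_equivalence G).trans h h'⟩ }

theorem familyStructure_rel (G : ℕ → Prop) : (familyStructure G).rel = FamilyRel G := by
  funext x y
  exact propext ⟨fun ⟨_, _, h⟩ => h, fun h => ⟨trivial, trivial, h⟩⟩

theorem familyStructure_isComputable {G : ℕ → Prop} (hG : ComputablePred G) :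
    (familyStructure G).IsComputable := by
  refine ⟨ComputablePred.const True, ?_⟩
  change ComputablePred fun p : ℕ × ℕ => (familyStructure G).rel p.1 p.2
  rw [familyStructure_rel]
  exact (familyRel_computable (G := fun z : Unit × ℕ => G z.2) (hG.comp Computable.snd)).comp
    (f := fun p : ℕ × ℕ => ((), p)) ((Computable.const ()).pair Computable.id)

/-! ### Total functions that are recursive in a set -/

/-- The total function `f` is recursive in the set `X`. -/
def TotalRecursiveIn (X : Set ℕ) (f : ℕ → ℕ) : Prop :=
  Nat.RecursiveIn {charFun X} fun n => Part.some (f n)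

namespace TotalRecursiveIn

variable {X : Set ℕ} {f g : ℕ → ℕ}

theorem of_computable (hf : Computable f) : TotalRecursiveIn X f :=
  (Partrec.nat_iff.1 hf).recursiveIn

theorem comp (hf : TotalRecursiveIn X f) (hg : TotalRecursiveIn X g) :
    TotalRecursiveIn X fun n => f (g n) :=
  (Nat.RecursiveIn.comp hf hg).of_eq fun _ => Part.bind_some _ _

theorem pair (hf : TotalRecursiveIn X f) (hg : TotalRecursiveIn X g) :
    TotalRecursiveIn X fun n => Nat.pair (f n) (g n) :=
  (Nat.RecursiveIn.pair hf hg).of_eq fun n => by simp [Seq.seq]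

theorem sInf_zero (hf : TotalRecursiveIn X f) (hex : ∀ a, ∃ n, f (Nat.pair a n) = 0) :
    TotalRecursiveIn X fun a => sInf {n | f (Nat.pair a n) = 0} := by
  refine (Nat.RecursiveIn.rfind hf).of_eq fun a => Part.eq_some_iff.2 (Nat.mem_rfind.2 ⟨?_, ?_⟩)
  · have : f (Nat.pair a (sInf {n | f (Nat.pair a n) = 0})) = 0 := Nat.sInf_mem (hex a)
    simp [this]
  · intro m hm
    have : f (Nat.pair a m) ≠ 0 :=
      Nat.notMem_of_lt_sInf (s := {n | f (Nat.pair a n) = 0}) hm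
    simp [this]

end TotalRecursiveIn

/-! ### The second jump is computable from embeddings -/

/-- Every question `i ∈ 0''` has a `Π⁰₂`-verifiable answer: 0 for "no", and `x + 1` for "yes" with
`x` a witness of the `Σ⁰₂` definition. Lists of such answers exist in every length, and
`exists_witness_lists` makes the correct ones the infinite columns, one for each length. -/
theorem exists_computable_structure_coding_zeroJump_two :
    ∃ G : ℕ → Prop, ComputablePred G ∧
      {c | {t | G (Nat.pair c t)}.Infinite}.Infinite ∧
      (∀ c, {t | G (Nat.pair c t)}.Infinite → ∀ i v,
        (Denumerable.ofNat (List ℕ) c)[i]? = some v → (v.unpair.1 ≠ 0 ↔ i ∈ zeroJump 2)) ∧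
      ∀ c c', {t | G (Nat.pair c t)}.Infinite → {t | G (Nat.pair c' t)}.Infinite →
        (Denumerable.ofNat (List ℕ) c).length = (Denumerable.ofNat (List ℕ) c').length →
          c = c' := by
  have hsigma : ArithSigma 2 fun e => e ∈ zeroJump 2 := arithSigma_turingJump_turingJump
  obtain ⟨q, hq, hmem⟩ := hsigma
  let p : (ℕ × ℕ) × ℕ → Prop := fun z =>
    (z.2 = 0 ∧ z.1.2 ∉ zeroJump 2) ∨ (z.2 ≠ 0 ∧ ¬ q (z.1.2, z.2 - 1))
  have hp : ArithPi 2 p := by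
    have h12 : Computable fun z : (ℕ × ℕ) × ℕ => z.1.2 := Computable.snd.comp Computable.fst
    have h0 : ComputablePred fun z : (ℕ × ℕ) × ℕ => z.2 = 0 :=
      Computable.eq_pred Computable.snd (Computable.const 0)
    refine ArithPi.or (h0.arithPi.and ?_) (h0.not.arithPi.and ?_)
    · exact (arithSigma_turingJump_turingJump.comp h12).not
    · exact ((hq.comp (f := fun z : (ℕ × ℕ) × ℕ => (z.1.2, z.2 - 1))
        (h12.pair (Computable.pred.comp Computable.snd))).not).succ
  have hpmem : ∀ b i v, p ((b, i), v) → (v ≠ 0 ↔ i ∈ zeroJump 2) := by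
    rintro b i v (⟨rfl, hi⟩ | ⟨hv, hi⟩)
    · simpa using hi
    · exact iff_of_true hv ((hmem i).2 ⟨_, hi⟩)
  have hpex : ∀ b i, ∃ v, p ((b, i), v) := by
    intro b i
    by_cases hi : i ∈ zeroJump 2
    · obtain ⟨x, hx⟩ := (hmem i).1 hi
      exact ⟨x + 1, Or.inr ⟨by simp, by simpa using hx⟩⟩
    · exact ⟨0, Or.inl ⟨rfl, hi⟩⟩
  obtain ⟨G, hG, h⟩ := hp.exists_witness_lists
  -- The parameter plays no role here and is set to 0.
  obtain ⟨h1, h2, h3⟩ := h 0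
  refine ⟨fun n => G (0, n), hG.comp ((Computable.const 0).pair Computable.id), ?_,
    fun c hc i v hv => hpmem 0 i _ (h1 c hc i v hv), h2⟩
  choose c hc hlen using fun n => h3 n fun i _ => hpex 0 i
  refine (Set.infinite_range_of_injective (f := c) fun m n hmn => ?_).mono ?_
  · rw [← hlen m, ← hlen n, hmn]
  · rintro _ ⟨n, rfl⟩
    exact hc n

open EquivStructure in
theorem zeroJump_two_le_of_computesEmbeddings {A : EquivStructure} (hA : ManyClasses A.rel ⊤)
    {Y : Set ℕ} (hY : A.ComputesEmbeddings Y) : SetTuringReducible (zeroJump 2) Y := by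
  classical
  obtain ⟨G, hG, hinf, hcode, hlen⟩ := exists_computable_structure_coding_zeroJump_two
  let B := familyStructure fun _ => True
  let C := familyStructure G
  have hBmany : ManyClasses B.rel ⊤ := by
    rw [familyStructure_rel, manyClasses_familyRel_iff]
    simp [Set.infinite_univ]
  have hCmany : ManyClasses C.rel ⊤ := by
    rw [familyStructure_rel, manyClasses_familyRel_iff]
    exact hinf
  obtain ⟨f, hf⟩ := hY B C (familyStructure_isComputable (ComputablePred.const True))
    (familyStructure_isComputable hG)
    ⟨nonempty_embedding_of_manyClasses hBmany, nonempty_embedding_of_manyClasses hA⟩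
    ⟨nonempty_embedding_of_manyClasses hCmany, nonempty_embedding_of_manyClasses hA⟩
  have hrec : TotalRecursiveIn Y f.toFun := by
    refine (RecursiveIn.iff_nat.1 hf).of_eq fun n => Part.eq_some_iff.2 ⟨trivial, ?_⟩
    exact (f.toFun_coe ⟨n, trivial⟩).symm
  let F : ℕ → ℕ := fun n => f.toFun (Nat.pair n 0)
  have hF : TotalRecursiveIn Y F := hrec.comp (.of_computable
    (Computable.natPair Computable.id (Computable.const 0)))
  have hemb : ∀ m n, (FamilyRel (fun _ => True) m n ↔ FamilyRel G (f.toFun m) (f.toFun n)) := by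
    intro m n
    have := (f.embedsOn m n trivial trivial (rel_self.2 trivial) (rel_self.2 trivial)).1
    rwa [familyStructure_rel, familyStructure_rel] at this
  have hFinf : ∀ n, G (F n) ∧ {t | G (Nat.pair (F n).unpair.1 t)}.Infinite := by
    intro n
    refine classCard_familyRel_eq_top_iff.1 (top_le_iff.1 ?_)
    rw [← familyStructure_rel G]
    refine le_trans (ge_of_eq ?_) (f.embedsOn.classCard_le B.isPER_rel
      (n := Nat.pair n 0) (rel_self.2 trivial))
    rw [familyStructure_rel, classCard_familyRel_eq_top_iff]
    simp [Set.infinite_univ]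
  have hFinj : Function.Injective fun n => (F n).unpair.1 := by
    intro m n hmn
    rcases (hemb (Nat.pair m 0) (Nat.pair n 0)).2 (Or.inr ⟨hmn, (hFinf m).1, (hFinf n).1⟩)
      with h | ⟨h, -⟩
    · exact (Nat.pair_eq_pair.1 h).1
    · simpa using h
  let L : ℕ → List ℕ := fun y => Denumerable.ofNat (List ℕ) y.unpair.1
  have hL : Computable L := (Computable.ofNat _).comp (Computable.unpair_fst Computable.id)
  -- Different classes go to different columns, and correct lists of equal length coincide, so the
  -- lengths are pairwise different and hence unbounded.
  have hlong : ∀ i, ∃ n, i < (L (F n)).length := by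
    intro i
    have hinj : Function.Injective fun n => (L (F n)).length := fun m n hmn =>
      hFinj (hlen _ _ (hFinf m).2 (hFinf n).2 hmn)
    obtain ⟨_, ⟨n, rfl⟩, hn⟩ := (Set.infinite_range_of_injective hinj).exists_gt i
    exact ⟨n, hn⟩
  -- Truncated subtraction: the value at `⟨i, y⟩` is 0 exactly when the list `L y` has an entry at
  -- `i`.
  let test : ℕ → ℕ := fun z => z.unpair.1 + 1 - (L z.unpair.2).length
  have htest : Computable test := Primrec.nat_sub.to_comp.comp
    (Computable.succ.comp (Computable.unpair_fst Computable.id))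
    (Computable.list_length.comp (hL.comp (Computable.unpair_snd Computable.id)))
  let out : ℕ → ℕ := fun z => min 1 ((L z.unpair.2).getD z.unpair.1 0).unpair.1
  have hout : Computable out := Primrec.nat_min.to_comp.comp (Computable.const 1)
    (Computable.unpair_fst ((Primrec.list_getD 0).to_comp.comp
      (hL.comp (Computable.unpair_snd Computable.id)) (Computable.unpair_fst Computable.id)))
  have hleft : TotalRecursiveIn Y fun z => z.unpair.1 :=
    .of_computable (Computable.unpair_fst Computable.id)
  have hright : TotalRecursiveIn Y fun z => z.unpair.2 :=
    .of_computable (Computable.unpair_snd Computable.id)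
  have hsearch := ((TotalRecursiveIn.of_computable htest).comp
    (hleft.pair (hF.comp hright))).sInf_zero fun i => by
      obtain ⟨n, hn⟩ := hlong i
      exact ⟨n, by simp only [test, Nat.unpair_pair]; omega⟩
  have hdecide := (TotalRecursiveIn.of_computable hout).comp
    ((TotalRecursiveIn.of_computable Computable.id).pair (hF.comp hsearch))
  refine RecursiveIn.iff_nat.2 (hdecide.of_eq fun i => ?_)
  simp only [Nat.unpair_pair, id]
  set n := sInf {n | test (Nat.pair i (F n)) = 0} with hn
  have hn0 : test (Nat.pair i (F n)) = 0 :=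
    Nat.sInf_mem (s := {n | test (Nat.pair i (F n)) = 0}) (by
    obtain ⟨n, hn⟩ := hlong i
    exact ⟨n, by simp only [Set.mem_ofPred_eq, test, Nat.unpair_pair]; omega⟩)
  have hi : i < (L (F n)).length := by
    simp only [test, Nat.unpair_pair] at hn0
    omega
  have hkey := hcode _ (hFinf n).2 i _ (List.getElem?_eq_getElem hi)
  have hget : (L (F n)).getD i 0 = (L (F n))[i] := by
    simp [List.getD_eq_getElem?_getD, hi]
  simp only [out, Nat.unpair_pair, hget]
  change ((L (F n))[i]).unpair.1 ≠ 0 ↔ _ at hkey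
  by_cases hz : i ∈ zeroJump 2
  · have := hkey.2 hz
    rw [show min 1 ((L (F n))[i]).unpair.1 = 1 by omega]
    simp [charFun, hz]
  · have : ((L (F n))[i]).unpair.1 = 0 := not_not.1 fun h => hz (hkey.1 h)
    simp [charFun, hz, this]

/-! ### The index set -/

theorem arithSigma_phi {α : Type} [Primcodable α] {e x y k : α → ℕ} (he : Computable e)
    (hx : Computable x) (hy : Computable y) (hk : Computable k) :
    ArithSigma 1 fun a => phi (e a) (x a) (y a) = Part.some (k a) := by
  have h : ComputablePred fun z : α × ℕ => (Denumerable.ofNat Code (e z.1)).evaln z.2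
      (Nat.pair (x z.1) (y z.1)) = some (k z.1) :=
    Computable.eq_pred (Code.primrec_evaln.to_comp.comp
      ((Computable.snd.pair ((Computable.ofNat _).comp (he.comp Computable.fst))).pair
        (Computable.natPair (hx.comp Computable.fst) (hy.comp Computable.fst))))
      (Computable.option_some.comp (hk.comp Computable.fst))
  refine (ArithSigma.exists_nat h.arithSigma).of_iff fun a => ?_
  unfold phi
  rw [Part.eq_some_iff, Code.evaln_complete]
  rfl

theorem arithPi_isEquivIndex : ArithPi 2 IsEquivIndex := by
  have hphi : ∀ {α : Type} [Primcodable α] {e x y k : α → ℕ}, Computable e → Computable x →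
      Computable y → Computable k →
      ArithPi 2 fun a => phi (e a) (x a) (y a) = Part.some (k a) :=
    fun he hx hy hk => (arithSigma_phi he hx hy hk).pi_succ
  have h1 : ∀ k, Computable fun _ : (ℕ × ℕ) × ℕ => (k : ℕ) := fun k => Computable.const k
  have h11 : Computable fun z : (ℕ × ℕ) × ℕ => z.1.1 := Computable.fst.comp Computable.fst
  have h12 : Computable fun z : (ℕ × ℕ) × ℕ => z.1.2 := Computable.snd.comp Computable.fst
  have hvalues : ArithPi 2 fun e => ∀ x y, phi e x y = Part.some 0 ∨ phi e x y = Part.some 1 := by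
    refine ArithPi.forall_nat (p := fun z : ℕ × ℕ => ∀ y, phi z.1 z.2 y = Part.some 0 ∨
      phi z.1 z.2 y = Part.some 1) ?_
    refine ArithPi.forall_nat (p := fun z : (ℕ × ℕ) × ℕ => phi z.1.1 z.1.2 z.2 = Part.some 0 ∨
      phi z.1.1 z.1.2 z.2 = Part.some 1) ?_
    exact (hphi h11 h12 Computable.snd (h1 0)).or (hphi h11 h12 Computable.snd (h1 1))
  have hrefl : ArithPi 2 fun e => ∀ x, phi e x x = Part.some 1 :=
    ArithPi.forall_nat (p := fun z : ℕ × ℕ => phi z.1 z.2 z.2 = Part.some 1)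
      (hphi Computable.fst Computable.snd Computable.snd (Computable.const 1))
  have hsymm : ArithPi 2 fun e => ∀ x y, phi e x y = Part.some 1 → phi e y x = Part.some 1 := by
    refine ArithPi.forall_nat (p := fun z : ℕ × ℕ => ∀ y, phi z.1 z.2 y = Part.some 1 →
      phi z.1 y z.2 = Part.some 1) ?_
    refine ArithPi.forall_nat (p := fun z : (ℕ × ℕ) × ℕ => phi z.1.1 z.1.2 z.2 = Part.some 1 →
      phi z.1.1 z.2 z.1.2 = Part.some 1) ?_
    exact ArithPi.imp (arithSigma_phi h11 h12 Computable.snd (h1 1)).succ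
      (hphi h11 Computable.snd h12 (h1 1))
  have htrans : ArithPi 2 fun e => ∀ x y z, phi e x y = Part.some 1 → phi e y z = Part.some 1 →
      phi e x z = Part.some 1 := by
    refine ArithPi.forall_nat (p := fun w : ℕ × ℕ => ∀ y z, phi w.1 w.2 y = Part.some 1 →
      phi w.1 y z = Part.some 1 → phi w.1 w.2 z = Part.some 1) ?_
    refine ArithPi.forall_nat (p := fun w : (ℕ × ℕ) × ℕ => ∀ z, phi w.1.1 w.1.2 w.2 = Part.some 1 →
      phi w.1.1 w.2 z = Part.some 1 → phi w.1.1 w.1.2 z = Part.some 1) ?_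
    refine ArithPi.forall_nat (p := fun w : ((ℕ × ℕ) × ℕ) × ℕ =>
      phi w.1.1.1 w.1.1.2 w.1.2 = Part.some 1 → phi w.1.1.1 w.1.2 w.2 = Part.some 1 →
        phi w.1.1.1 w.1.1.2 w.2 = Part.some 1) ?_
    have h111 := h11.comp (Computable.fst (α := (ℕ × ℕ) × ℕ) (β := ℕ))
    have h112 := h12.comp (Computable.fst (α := (ℕ × ℕ) × ℕ) (β := ℕ))
    have h12' : Computable fun w : ((ℕ × ℕ) × ℕ) × ℕ => w.1.2 := Computable.snd.comp Computable.fst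
    exact ArithPi.imp (arithSigma_phi h111 h112 h12' (Computable.const 1)).succ
      (ArithPi.imp (arithSigma_phi h111 h12' Computable.snd (Computable.const 1)).succ
        (hphi h111 h112 Computable.snd (Computable.const 1)))
  refine (hvalues.and (hrefl.and (hsymm.and htrans))).of_iff fun e => ?_
  exact ⟨fun ⟨h1, h2⟩ => ⟨h1, h2.refl, fun _ _ => h2.symm, fun _ _ _ => h2.trans⟩,
    fun ⟨h1, h2, h3, h4⟩ => ⟨h1, h2, fun {x y} => h3 x y, fun {x y z} => h4 x y z⟩⟩

theorem structureOfIndex_rel {e : ℕ} (h : IsEquivIndex e) (x y : ℕ) :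
    (structureOfIndex e h).rel x y ↔ phi e x y = Part.some 1 :=
  ⟨fun ⟨_, _, h⟩ => h, fun h => ⟨trivial, trivial, h⟩⟩

/-- Finite sets are replaced by initial segments and infinity by unboundedness, so that all
quantifiers range over numbers and can be counted. -/
theorem manyClasses_top_iff {R : ℕ → ℕ → Prop} : ManyClasses R ⊤ ↔
    ∀ n, ∃ x, R x x ∧ (∀ y, y < n → ¬ R y x) ∧ ∀ m, ∃ k, m < k ∧ R k x := by
  have hinf : ∀ x, ⊤ ≤ classCard R x ↔ ∀ m, ∃ k, m < k ∧ R k x := by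
    intro x
    unfold classCard
    rw [top_le_iff, Set.encard_eq_top_iff]
    constructor
    · intro h m
      obtain ⟨k, hk, hmk⟩ := h.exists_gt m
      exact ⟨k, hmk, hk⟩
    · intro h
      refine Set.infinite_of_forall_exists_gt fun m => ?_
      obtain ⟨k, hmk, hk⟩ := h m
      exact ⟨k, hk, hmk⟩
  constructor
  · intro h n
    obtain ⟨x, h1, h2, h3⟩ := h (Finset.range n)
    exact ⟨x, h1, fun y hy => h2 y (Finset.mem_range.2 hy), (hinf x).1 h3⟩
  · intro h F
    obtain ⟨x, h1, h2, h3⟩ := h (F.sup id + 1)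
    exact ⟨x, h1, fun s hs => h2 s (Nat.lt_succ_of_le (Finset.le_sup (f := id) hs)), (hinf x).2 h3⟩

/-- That the class of `x` is infinite and misses an initial segment is `Π⁰₂`; the quantifiers `∀ n,
∃ x` in front give `Π⁰₄`, and being an index is only `Π⁰₂`. -/
theorem arithPi_infinitelyManyInfiniteClasses :
    ArithPi 4 fun e => ∃ h : IsEquivIndex e,
      (structureOfIndex e h).HasInfinitelyManyInfiniteClasses := by
  have hmain : ArithPi 4 fun e => ∀ n, ∃ x, (∀ y, y < n → ¬ phi e y x = Part.some 1) ∧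
      ∀ m, ∃ k, m < k ∧ phi e k x = Part.some 1 := by
    refine ArithPi.forall_nat (p := fun z : ℕ × ℕ => ∃ x,
      (∀ y, y < z.2 → ¬ phi z.1 y x = Part.some 1) ∧
        ∀ m, ∃ k, m < k ∧ phi z.1 k x = Part.some 1) ?_
    refine ArithSigma.pi_succ (ArithSigma.exists_nat (p := fun z : (ℕ × ℕ) × ℕ =>
      (∀ y, y < z.1.2 → ¬ phi z.1.1 y z.2 = Part.some 1) ∧
        ∀ m, ∃ k, m < k ∧ phi z.1.1 k z.2 = Part.some 1) (ArithPi.sigma_succ ?_))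
    refine ArithPi.and ?_ ?_
    · refine ArithPi.forall_nat (p := fun z : ((ℕ × ℕ) × ℕ) × ℕ => z.2 < z.1.1.2 →
        ¬ phi z.1.1.1 z.2 z.1.2 = Part.some 1) ?_
      have h11 : Computable fun z : ((ℕ × ℕ) × ℕ) × ℕ => z.1.1 :=
        Computable.fst.comp Computable.fst
      refine ArithPi.imp (Computable.lt_pred Computable.snd
        (Computable.snd.comp h11)).arithSigma (ArithPi.succ ?_)
      exact (arithSigma_phi (Computable.fst.comp h11) Computable.snd
        (Computable.snd.comp Computable.fst) (Computable.const 1)).not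
    · refine ArithPi.forall_nat (p := fun z : ((ℕ × ℕ) × ℕ) × ℕ => ∃ k, z.2 < k ∧
        phi z.1.1.1 k z.1.2 = Part.some 1) ?_
      refine ArithSigma.pi_succ (ArithSigma.exists_nat (p := fun z : (((ℕ × ℕ) × ℕ) × ℕ) × ℕ =>
        z.1.2 < z.2 ∧ phi z.1.1.1.1 z.2 z.1.1.2 = Part.some 1) ?_)
      have h11 : Computable fun z : (((ℕ × ℕ) × ℕ) × ℕ) × ℕ => z.1.1 :=
        Computable.fst.comp Computable.fst
      refine ArithSigma.and (Computable.lt_pred (Computable.snd.comp Computable.fst)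
        Computable.snd).arithSigma (arithSigma_phi ?_ Computable.snd
          (Computable.snd.comp h11) (Computable.const 1))
      exact Computable.fst.comp (Computable.fst.comp h11)
  refine (arithPi_isEquivIndex.succ.succ.and hmain).of_iff fun e => ?_
  rw [← exists_prop]
  refine exists_congr fun h => ?_
  rw [EquivStructure.hasInfinitelyManyInfiniteClasses_iff,
    manyClasses_top_iff]
  simp only [structureOfIndex_rel, h.2.refl, true_and]

/-- The s-m-n theorem; currying is injective in the parameter, which yields a one-one reduction. -/
theorem exists_index_of_computable {E : ℕ × (ℕ × ℕ) → Prop} (hE : ComputablePred E)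
    (hequiv : ∀ b, Equivalence fun x y => E (b, (x, y))) :
    ∃ f : ℕ → ℕ, Computable f ∧ Function.Injective f ∧ ∀ b, IsEquivIndex (f b) ∧
      ∀ x y, phi (f b) x y = Part.some 1 ↔ E (b, (x, y)) := by
  classical
  have hfun : Computable fun z : ℕ =>
      bif decide (E (z.unpair.1, z.unpair.2.unpair)) then 1 else 0 := by
    refine Computable.cond (hE.decide.comp ((Computable.unpair_fst Computable.id).pair
      (Computable.unpair.comp (Computable.unpair_snd Computable.id))))
      (Computable.const 1) (Computable.const 0)
  obtain ⟨c, hc⟩ := Code.exists_code.1 (Partrec.nat_iff.1 hfun)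
  have hphi : ∀ b x y, phi (Encodable.encode (c.curry b)) x y =
      Part.some (if E (b, (x, y)) then 1 else 0) := by
    intro b x y
    unfold phi
    rw [Denumerable.ofNat_encode, Code.eval_curry, hc]
    simp [Bool.cond_decide]
  have hone : ∀ b x y, phi (Encodable.encode (c.curry b)) x y = Part.some 1 ↔ E (b, (x, y)) := by
    intro b x y
    rw [hphi]
    by_cases h : E (b, (x, y)) <;> simp [h]
  refine ⟨fun b => Encodable.encode (c.curry b), Computable.encode.comp
    (Code.primrec₂_curry.to_comp.comp (Computable.const c) Computable.id), fun b b' h =>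
      (Code.curry_inj (Encodable.encode_injective h)).2, fun b => ⟨⟨fun x y => ?_, ?_⟩, hone b⟩⟩
  · rw [hphi]
    by_cases h : E (b, (x, y)) <;> simp [h]
  · simpa only [hone] using hequiv b

/-- The infinite classes of the structure for `b` correspond to the unique witness lists for initial
segments of `∀ i, ∃ v, ¬ r ((b, i), v)`, at most one for each length. -/
theorem oneOneReducible_infinitelyManyInfiniteClasses {B : Set ℕ} (hB : IsPi0 4 B) :
    OneOneReducible (fun b => b ∈ B) fun e => ∃ h : IsEquivIndex e,
      (structureOfIndex e h).HasInfinitelyManyInfiniteClasses := by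
  obtain ⟨q, ⟨r, hr, hqr⟩, hBq⟩ := isPi0_iff.1 hB
  have hBr : ∀ b, b ∈ B ↔ ∀ i, ∃ v, ¬ r ((b, i), v) := fun b => by
    simp only [← hqr]
    simpa using not_congr (hBq b)
  obtain ⟨G, hG, h⟩ := ArithPi.exists_witness_lists hr.not
  obtain ⟨f, hf, hinj, hindex⟩ := exists_index_of_computable (familyRel_computable hG)
    fun b => familyRel_equivalence fun n => G (b, n)
  refine ⟨f, hf, hinj, fun b => ?_⟩
  have hrel : (structureOfIndex (f b) (hindex b).1).rel = FamilyRel fun n => G (b, n) := by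
    funext x y
    exact propext ((structureOfIndex_rel _ x y).trans ((hindex b).2 x y))
  beta_reduce
  rw [exists_prop_of_true (hindex b).1, EquivStructure.hasInfinitelyManyInfiniteClasses_iff, hrel,
    manyClasses_familyRel_iff, hBr]
  obtain ⟨h1, h2, h3⟩ := h b
  constructor
  · intro hall
    choose c hc hlen using fun n => h3 n fun i _ => hall i
    refine (Set.infinite_range_of_injective (f := c) fun m n hmn => ?_).mono ?_
    · rw [← hlen m, ← hlen n, hmn]
    · rintro _ ⟨n, rfl⟩
      exact hc n
  · intro hinf i
    by_contra hi
    -- If `i` has no witness, no correct list has an entry at `i`, so the lengths are at most `i`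
    -- and there are finitely many lists.
    refine hinf (Set.Finite.of_finite_image
      (f := fun c => (Denumerable.ofNat (List ℕ) c).length)
      ((Set.finite_le_nat i).subset ?_) fun c hc c' hc' => h2 c c' hc hc')
    rintro _ ⟨c, hc, rfl⟩
    change (Denumerable.ofNat (List ℕ) c).length ≤ i
    by_contra hlt
    exact hi ⟨_, h1 c hc i _ (List.getElem?_eq_getElem (not_le.1 hlt))⟩

/-! ### Degrees of bi-embeddable categoricity -/

namespace EquivStructure

theorem nonempty_embedding_of_biEmbeddable {A B C : EquivStructure} (hB : BiEmbeddable A B)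
    (hC : BiEmbeddable A C) : Nonempty (Embedding B C) := by
  obtain ⟨f⟩ := hB.2
  obtain ⟨g⟩ := hC.1
  exact ⟨f.trans g⟩

theorem computesEmbeddings_zeroJump_two (A : EquivStructure) :
    A.ComputesEmbeddings (zeroJump 2) := fun _ _ hB hC hAB hAC =>
  exists_embedding_le_zeroJump_two hB hC (nonempty_embedding_of_biEmbeddable hAB hAC)

theorem computesEmbeddings_zeroJump_one {A : EquivStructure} (hA : ¬ ManyClasses A.rel ⊤) :
    A.ComputesEmbeddings (zeroJump 1) := fun _ _ hB hC hAB hAC =>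
  exists_embedding_le_zeroJump_one hB hC (nonempty_embedding_of_biEmbeddable hAB hAC)
    fun hmany => hAC.2.elim fun f => hA (f.manyClasses hmany)

/-- With finitely many infinite classes `0'` computes the embeddings, and minimality of `0''` would
put it below `0'`. -/
theorem hasBiembCatDegree_iff (A : EquivStructure) :
    A.HasBiembCatDegree (turingJump (turingJump ∅)) ↔ A.HasInfinitelyManyInfiniteClasses := by
  rw [hasInfinitelyManyInfiniteClasses_iff]
  constructor
  · intro h
    by_contra hA
    exact turingJump_not_le _ (h.2 _ (computesEmbeddings_zeroJump_one hA))
  · exact fun hA => ⟨computesEmbeddings_zeroJump_two A,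
      fun _ hY => zeroJump_two_le_of_computesEmbeddings hA hY⟩

end EquivStructure

theorem mainTheorem8 :
    IsPi0Complete 4 zeroDoubleJumpIndexSet ∧
    zeroDoubleJumpIndexSet =
      {e : ℕ | ∃ h : IsEquivIndex e,
        (structureOfIndex e h).HasInfinitelyManyInfiniteClasses} := by
  have heq : zeroDoubleJumpIndexSet = {e : ℕ | ∃ h : IsEquivIndex e,
      (structureOfIndex e h).HasInfinitelyManyInfiniteClasses} := by
    ext e
    exact exists_congr fun h => EquivStructure.hasBiembCatDegree_iff _
  refine ⟨?_, heq⟩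
  rw [heq]
  exact ⟨isPi0_iff.2 arithPi_infinitelyManyInfiniteClasses,
    fun B hB => oneOneReducible_infinitelyManyInfiniteClasses hB⟩
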